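/- A two-neighbor cellular automaton rule on $n$ states is a map $f:\mathbb{Z}_n^2\to\mathbb{Z}_n$, where $\mathbb{Z}_n=\{0,\dots,n-1\}$; it updates a configuration $\xi_t:\mathbb{Z}\to\mathbb{Z}_n$ by $\xi_{t+1}(x)=f(\xi_t(x-1),\xi_t(x))$ for all $x\in\mathbb{Z}$. A periodic solution of $f$ with temporal period $\tau$ and spatial period $\sigma$ is a trajectory $(\xi_t)_{t\ge 0}$ such that $\sigma$ is the smallest positive integer with $\xi_0(x+\sigma)=\xi_0(x)$ for all $x$, and $\tau$ is the smallest positive integer with $\xi_\tau=\xi_0$. It is identified with its tile, the matrix $(a_{i,j})=(\xi_i(j))_{0\le i<\tau,\,0\le j<\sigma}$ with subscripts read modulo $\tau$ and $\sigma$, taken up to rotations $(a_{i,j})\mapsto(a_{i+u,j+v})$. The lag of a tile is the number of different pairs $(a_{i,j},a_{i,j+1})$ minus the number of different states $a_{i,j}$; a periodic solution is simple if its tile has lag $0$. **Theorem.** Fix integers $\tau\ge1$ and $\sigma\ge1$ and let $$\lambda_{\tau,\sigma}=\frac{1}{\tau\sigma}\sum_{d\mid\gcd(\tau,\sigma)}\varphi(d)\,d,$$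 where $\varphi$ is Euler's totient function. Choose a rule uniformly at random among the $n^{n^2}$ two-neighbor rules on $n$ states, let $\mathcal{P}_{\tau,\sigma,n}$ be the random set of its periodic solutions with temporal period $\tau$ and spatial period $\sigma$, and let $W_n$ be the number of simple elements of $\mathcal{P}_{\tau,\sigma,n}$. Then: 1. $\mathbb{P}(\mathcal{P}_{\tau,\sigma,n}\ne\emptyset)\to 1-\exp(-\lambda_{\tau,\sigma})$ as $n\to\infty$. 2. The probability that $\mathcal{P}_{\tau,\sigma,n}$ contains a non-simple periodic solution is $\mathcal{O}(1/n)$. 3. With $\lambda_n=\mathbb{E}W_n$, the total variation distance between the law of $W_n$ and the Poisson law with mean $\lambda_n$ is $\mathcal{O}(1/n)$, and $\lambda_n\to\lambda_{\tau,\sigma}$ as $n\to\infty$. The constants in the $\mathcal{O}(1/n)$ bounds depend only on $\tau$ and $\sigma$. -/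

import Mathlib

open Filter Topology MeasureTheory

namespace RandomCA

/-- A two-neighbor rule on the `n` states `0, …, n - 1`. -/
abbrev Rule (n : ℕ) := Fin n × Fin n → Fin n

/-- A spatial configuration: a state at every site of `ℤ`. -/
abbrev Config (n : ℕ) := ℤ → Fin n

/-- One update of the automaton: `ξ' x = f (ξ (x - 1), ξ x)`. -/
def step {n : ℕ} (f : Rule n) (ξ : Config n) : Config n :=
  fun x => f (ξ (x - 1), ξ x)

/-- The configuration at time `t` of the trajectory started from `ξ`. -/
def traj {n : ℕ} (f : Rule n) (ξ : Config n) (t : ℕ) : Config n :=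
  (step f)^[t] ξ

/-- Started from `ξ`, the rule `f` runs through a periodic solution with minimal temporal
period `τ` and minimal spatial period `σ`. -/
def HasPeriods {n : ℕ} (f : Rule n) (τ σ : ℕ) (ξ : Config n) : Prop :=
  IsLeast {s : ℕ | 0 < s ∧ ∀ x : ℤ, ξ (x + s) = ξ x} σ ∧
  IsLeast {t : ℕ | 0 < t ∧ ∀ x : ℤ, traj f ξ t x = ξ x} τ

/-- Matrices with `τ` rows and `σ` columns, the subscripts being read modulo `τ` and `σ`. -/
abbrev Block (n τ σ : ℕ) := Matrix (ZMod τ) (ZMod σ) (Fin n)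

/-- The number of different states in a block. -/
noncomputable def Block.numStates {n τ σ : ℕ} (A : Block n τ σ) : ℕ :=
  (Set.range fun p : ZMod τ × ZMod σ => A p.1 p.2).ncard

/-- The number of different horizontally adjacent pairs of states in a block, that is, the
number of values of the rule that the block specifies. -/
noncomputable def Block.numAssignments {n τ σ : ℕ} (A : Block n τ σ) : ℕ :=
  (Set.range fun p : ZMod τ × ZMod σ => (A p.1 p.2, A p.1 (p.2 + 1))).ncard

/-- Two blocks are identified if they differ by a space-time rotation. -/
def rotation (n τ σ : ℕ) : Setoid (Block n τ σ) where
  r A B := ∃ (u : ZMod τ) (v : ZMod σ), ∀ i j, B i j = A (i + u) (j + v)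
  iseqv :=
    { refl := fun _ => ⟨0, 0, fun i j => by simp⟩
      symm := by
        rintro A B ⟨u, v, h⟩
        exact ⟨-u, -v, fun i j => by simp [h]⟩
      trans := by
        rintro A B C ⟨u, v, h⟩ ⟨u', v', h'⟩
        exact ⟨u' + u, v' + v, fun i j => by simp [h, h', add_assoc]⟩ }

/-- Blocks up to space-time rotation. -/
def Tile (n τ σ : ℕ) := Quotient (rotation n τ σ)

theorem numStates_rotation {n τ σ : ℕ} {A B : Block n τ σ}
    (h : (rotation n τ σ).r A B) : A.numStates = B.numStates := by
  obtain ⟨u, v, h⟩ := h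
  unfold Block.numStates
  congr 1
  ext a
  constructor
  · rintro ⟨⟨i, j⟩, rfl⟩
    exact ⟨(i - u, j - v), by simp [h]⟩
  · rintro ⟨⟨i, j⟩, rfl⟩
    exact ⟨(i + u, j + v), by simp [h]⟩

theorem numAssignments_rotation {n τ σ : ℕ} {A B : Block n τ σ}
    (h : (rotation n τ σ).r A B) : A.numAssignments = B.numAssignments := by
  obtain ⟨u, v, h⟩ := h
  unfold Block.numAssignments
  congr 1
  ext a
  constructor
  · rintro ⟨⟨i, j⟩, rfl⟩
    refine ⟨(i - u, j - v), ?_⟩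
    have e : j - v + 1 + v = j + 1 := by ring
    simp [h, e]
  · rintro ⟨⟨i, j⟩, rfl⟩
    refine ⟨(i + u, j + v), ?_⟩
    have e : j + v + 1 = j + 1 + v := by ring
    simp [h, e]

/-- The lag of a tile: number of assignments minus number of states. -/
noncomputable def Tile.lag {n τ σ : ℕ} (T : Tile n τ σ) : ℤ :=
  Quotient.lift (s := rotation n τ σ)
    (fun A : Block n τ σ => (A.numAssignments : ℤ) - A.numStates)
    (fun _ _ h => by
      simp only [numAssignments_rotation h, numStates_rotation h]) T

/-- A tile is simple if its lag vanishes. -/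
def Tile.IsSimple {n τ σ : ℕ} (T : Tile n τ σ) : Prop := T.lag = 0

/-- The tile cut out of the space-time configuration started from `ξ`: rows are times
`0, …, τ - 1` and columns are sites `0, …, σ - 1`. -/
def tileOf {n : ℕ} (f : Rule n) (τ σ : ℕ) (ξ : Config n) : Tile n τ σ :=
  Quotient.mk (rotation n τ σ) fun i j => traj f ξ i.val (j.val : ℤ)

/-- The set of periodic solutions of `f` with temporal period `τ` and spatial period `σ`,
periodic solutions being identified with their tiles. -/
def periodicSolutions {n : ℕ} (τ σ : ℕ) (f : Rule n) : Set (Tile n τ σ) :=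
  {T | ∃ ξ : Config n, HasPeriods f τ σ ξ ∧ tileOf f τ σ ξ = T}

/-- The set of simple periodic solutions. -/
def simpleSolutions {n : ℕ} (τ σ : ℕ) (f : Rule n) : Set (Tile n τ σ) :=
  {T | T ∈ periodicSolutions τ σ f ∧ T.IsSimple}

/-- The number of simple periodic solutions of a rule. -/
noncomputable def simpleCount (n τ σ : ℕ) (f : Rule n) : ℕ :=
  (simpleSolutions τ σ f).ncard

/-- The uniform distribution on the `n ^ (n ^ 2)` rules with `n` states. -/
noncomputable def ruleMeasure (n : ℕ) : Measure (Rule n) :=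
  ProbabilityTheory.uniformOn Set.univ

/-- The expected number of simple periodic solutions of a random rule. -/
noncomputable def simpleMean (n τ σ : ℕ) : ℝ :=
  ∫ f, (simpleCount n τ σ f : ℝ) ∂ruleMeasure n

/-- The law of the number of simple periodic solutions of a random rule. -/
noncomputable def simpleLaw (n τ σ : ℕ) : Measure ℕ :=
  (ruleMeasure n).map (simpleCount n τ σ)

/-- Total variation distance of two probability measures on `ℕ`. -/
noncomputable def tvDist (μ ν : Measure ℕ) : ℝ :=
  ⨆ A : Set ℕ, |μ.real A - ν.real A|

/-- The constant `λ_{τ,σ}`. -/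
noncomputable def lam (τ σ : ℕ) : ℝ :=
  1 / ((τ : ℝ) * σ) * ∑ d ∈ (Nat.gcd τ σ).divisors, (Nat.totient d : ℝ) * d

end RandomCA

/-! A tile with `s` states and `a` assignments satisfies `s ≤ a`, because states are first
coordinates of adjacent pairs. If some rule produces it, a random rule does so with probability `n ^
(-a)`. Since there are only `O(n ^ s)` tiles with `s` states, tiles of positive lag contribute
`O(1/n)` to the expectation, and a union bound (`real_nonsimple_le`) disposes of them.

In a tile of lag 0 every state determines its right neighbor and hence, through the rule, the state
diagonally below. Equality of two states therefore propagates over the whole torus `ZMod τ × ZMod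
σ`: the level sets are the cosets of a subgroup `H`, and minimality of the periods says that `H`
meets both axes trivially. Conversely, every injection of the quotient by such an `H` into the
states gives a simple block (`Block.isSimple_iff`, `kernelEquiv`). With `q` the index of `H`, there
are `n.descFactorial q` such blocks, `q` in each rotation class, each produced with probability `n ^
(-q)`, so `H` contributes in the limit `1 / q = |H| / (τ σ)` to the mean. There are `φ(d)` such
subgroups of order `d` for each `d ∣ gcd(τ, σ)` (`card_axisFree`), and summing gives `lam`.

The Poisson limit comes from the Chen–Stein method, two tiles being neighbors when they share a
state. Tiles without a common state query the rule at disjoint sets of arguments, which gives the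
required independence. For neighbors both error terms gain a factor `1/n`: the union of the two
tiles has fewer states than the two have in total, and two distinct neighbors produced by one rule
have more assignments than states in their union, since otherwise the propagation argument would
make them rotations of each other (`real_sat_sat_le`). What remains is bounded by
`sum_inv_pow_ncard_range_le`, uniformly in `n`. -/

namespace RandomCA

section

open scoped Nat NNReal

/-! ### Stein's equation for the Poisson distribution -/

/-- Coefficients of the series that solves Stein's equation. -/
noncomputable def steinCoeff (r : ℝ) (k m : ℕ) : ℝ := r ^ m * ((k ! : ℝ) / ((k + 1 + m)! : ℝ))

theorem steinCoeff_nonneg {r : ℝ} (hr : 0 ≤ r) (k m : ℕ) : 0 ≤ steinCoeff r k m := by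
  unfold steinCoeff; positivity

theorem steinCoeff_le {r : ℝ} (hr : 0 ≤ r) (k m : ℕ) : steinCoeff r k m ≤ r ^ m / (m ! : ℝ) := by
  unfold steinCoeff
  rw [div_eq_mul_inv (r ^ m)]
  refine mul_le_mul_of_nonneg_left ?_ (by positivity)
  rw [div_le_iff₀ (by positivity), inv_mul_eq_div, le_div_iff₀ (by positivity)]
  have h1 : k ! * m ! ≤ (k + 1 + m)! :=
    (Nat.le_of_dvd (Nat.factorial_pos _) (Nat.factorial_mul_factorial_dvd_factorial_add k m)).trans
      (Nat.factorial_le (by omega))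
  exact_mod_cast h1

theorem summable_steinCoeff_mul {r : ℝ} (hr : 0 ≤ r) (k : ℕ) {h : ℕ → ℝ} (hh : ∀ j, |h j| ≤ 1) :
    Summable fun m => steinCoeff r k m * h (k + 1 + m) := by
  refine Summable.of_norm_bounded (Real.summable_pow_div_factorial r) fun m => ?_
  rw [Real.norm_eq_abs, abs_mul, abs_of_nonneg (steinCoeff_nonneg hr k m)]
  exact (mul_le_of_le_one_right (steinCoeff_nonneg hr k m) (hh _)).trans (steinCoeff_le hr k m)

/-- The bounded solution of Stein's equation. -/
noncomputable def steinSol (r : ℝ) (h : ℕ → ℝ) : ℕ → ℝ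
  | 0 => 0
  | k + 1 => -∑' m, steinCoeff r k m * h (k + 1 + m)

theorem abs_steinSol_le {r : ℝ} (hr : 0 ≤ r) {h : ℕ → ℝ} (hh : ∀ j, |h j| ≤ 1) (k : ℕ) :
    |steinSol r h k| ≤ Real.exp r := by
  cases k with
  | zero => simpa [steinSol] using (Real.exp_pos r).le
  | succ k =>
    rw [steinSol, abs_neg, Real.exp_eq_exp_ℝ, NormedSpace.exp_eq_tsum_div, ← Real.norm_eq_abs]
    refine tsum_of_norm_bounded (Real.summable_pow_div_factorial r).hasSum fun m => ?_
    rw [Real.norm_eq_abs, abs_mul, abs_of_nonneg (steinCoeff_nonneg hr k m)]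
    exact (mul_le_of_le_one_right (steinCoeff_nonneg hr k m) (hh _)).trans (steinCoeff_le hr k m)

/-- For positive `k`, the first term of the series for `k * steinSol r h k` yields `h k` and the
rest is the series for the next value. At `k = 0` the equation is the centering condition `h0`; the
default value `steinSol r h 0 = 0` is multiplied by zero there. -/
theorem steinSol_eq {r : ℝ} (hr : 0 ≤ r) {h : ℕ → ℝ} (hh : ∀ j, |h j| ≤ 1)
    (h0 : ∑' j, r ^ j / (j ! : ℝ) * h j = 0) (k : ℕ) :
    r * steinSol r h (k + 1) - k * steinSol r h k = h k := by
  cases k with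
  | zero =>
    have hs : Summable fun j => r ^ j / (j ! : ℝ) * h j := by
      refine Summable.of_norm_bounded (Real.summable_pow_div_factorial r) fun m => ?_
      rw [Real.norm_eq_abs, abs_mul, abs_of_nonneg (by positivity : 0 ≤ r ^ m / (m ! : ℝ))]
      exact mul_le_of_le_one_right (by positivity) (hh _)
    rw [hs.tsum_eq_zero_add] at h0
    have e : ∀ m, r * (steinCoeff r 0 m * h (0 + 1 + m))
        = r ^ (m + 1) / ((m + 1)! : ℝ) * h (m + 1) := by
      intro m
      simp only [steinCoeff, Nat.factorial_zero, zero_add, add_comm 1 m]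
      push_cast
      ring
    simp only [steinSol, Nat.cast_zero, zero_mul, sub_zero, mul_neg, ← tsum_mul_left, e]
    simp only [pow_zero, Nat.factorial_zero, Nat.cast_one, div_one, one_mul] at h0
    linarith
  | succ k =>
    have hs := summable_steinCoeff_mul hr k hh
    have e : ∀ m, r * (steinCoeff r (k + 1) m * h (k + 1 + 1 + m))
        = (k + 1 : ℝ) * (steinCoeff r k (m + 1) * h (k + 1 + (m + 1))) := by
      intro m
      have i1 : k + 1 + 1 + m = k + 1 + (m + 1) := by ring
      simp only [steinCoeff, i1, Nat.factorial_succ k]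
      push_cast
      ring
    have e0 : (k + 1 : ℝ) * steinCoeff r k 0 = 1 := by
      simp only [steinCoeff, pow_zero, one_mul, add_zero, Nat.factorial_succ k]
      have := Nat.factorial_ne_zero k
      push_cast
      field_simp
    simp only [steinSol]
    rw [hs.tsum_eq_zero_add, mul_neg, ← tsum_mul_left, tsum_congr e, tsum_mul_left]
    push_cast
    simp only [add_zero]
    linear_combination h (k + 1) * e0

/-- An indicator minus its Poisson mean is centered, so `steinSol_eq` applies. The crude bound `exp
r` suffices because the means of interest stay bounded. -/
theorem exists_stein_solution (r : ℝ≥0) (A : Set ℕ) :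
    ∃ g : ℕ → ℝ, (∀ k, |g k| ≤ Real.exp r) ∧
      ∀ k, (r : ℝ) * g (k + 1) - k * g k =
        A.indicator 1 k - (ProbabilityTheory.poissonMeasure r).real A := by
  set c := (ProbabilityTheory.poissonMeasure r).real A with hc
  have c0 : 0 ≤ c := measureReal_nonneg
  have c1 : c ≤ 1 := measureReal_le_one
  have hh : ∀ j, |A.indicator (1 : ℕ → ℝ) j - c| ≤ 1 := by
    intro j
    by_cases hj : j ∈ A <;> simp only [hj, Set.indicator_of_mem, Set.indicator_of_notMem,
      Pi.one_apply, not_false_eq_true] <;> rw [abs_le] <;> constructor <;> linarith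
  refine ⟨steinSol r fun j => A.indicator 1 j - c, abs_steinSol_le r.coe_nonneg hh,
    steinSol_eq r.coe_nonneg hh ?_⟩
  have hA : c = ∑' n, (Real.exp (-r) * r ^ n / (n)!) • A.indicator (1 : ℕ → ℝ) n := by
    rw [← ProbabilityTheory.integral_poissonMeasure, integral_indicator_one .of_discrete]
  have hone := ProbabilityTheory.hasSum_one_poissonMeasure r
  have hsA : Summable fun n : ℕ =>
      (Real.exp (-r) * r ^ n / (n)!) • A.indicator (1 : ℕ → ℝ) n := by
    refine Summable.of_norm_bounded hone.summable fun m => ?_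
    by_cases hm : m ∈ A <;> (simp [hm]; try positivity)
  have h2 := hsA.hasSum.sub (hone.mul_right c)
  rw [← hA, one_mul, sub_self] at h2
  have h3 := (h2.mul_left (Real.exp r)).tsum_eq
  rw [mul_zero] at h3
  refine Eq.trans ?_ h3
  refine tsum_congr fun j => ?_
  have : Real.exp (r : ℝ) * Real.exp (-r) = 1 := by rw [← Real.exp_add]; simp
  simp only [smul_eq_mul]
  linear_combination (- (r : ℝ) ^ j / (j ! : ℝ) * (A.indicator 1 j - c)) * this

/-! ### The Chen–Stein bound -/

open Classical in
/-- Chen–Stein bound for the number of events that occur, on a finite probability space with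
weights `w`, when each event is independent of the number of events outside its
neighborhood. -/
theorem chen_stein {Ω ι : Type*} [Fintype Ω] [Fintype ι] (w : Ω → ℝ) (hw : ∀ ω, 0 ≤ w ω)
    (hw1 : ∑ ω, w ω = 1) (X : ι → Ω → Prop) (N : ι → ι → Prop) (hN : ∀ i, N i i)
    (p : ι → ℝ) (hp : ∀ i, p i = ∑ ω, w ω * if X i ω then 1 else 0)
    (hind : ∀ i (F : ℕ → ℝ),
      ∑ ω, w ω * ((if X i ω then 1 else 0) * F (Finset.univ.filter fun j => ¬ N i j ∧ X j ω).card)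
        = p i * ∑ ω, w ω * F (Finset.univ.filter fun j => ¬ N i j ∧ X j ω).card)
    (r : ℝ≥0) (hr : (r : ℝ) = ∑ i, p i) (A : Set ℕ) :
    |∑ ω, w ω * A.indicator 1 (Finset.univ.filter fun j => X j ω).card
        - (ProbabilityTheory.poissonMeasure r).real A| ≤
      2 * Real.exp r * ((∑ i, ∑ j, if N i j then p i * p j else 0) +
        ∑ i, ∑ j, if N i j ∧ j ≠ i then ∑ ω, w ω * if X i ω ∧ X j ω then 1 else 0 else 0) := by
  obtain ⟨g, hg, hst⟩ := exists_stein_solution r A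
  set M := Real.exp r with hM
  set W : Ω → ℕ := fun ω => (Finset.univ.filter fun j => X j ω).card with hWdef
  set V : ι → Ω → ℕ := fun i ω => (Finset.univ.filter fun j => ¬ N i j ∧ X j ω).card with hVdef
  set x : ι → Ω → ℝ := fun i ω => if X i ω then 1 else 0 with hx
  have hx0 : ∀ i ω, 0 ≤ x i ω := fun i ω => by simp only [hx]; split_ifs <;> norm_num
  have hp0 : ∀ i, 0 ≤ p i := fun i => by
    rw [hp]; exact Finset.sum_nonneg fun ω _ => mul_nonneg (hw ω) (hx0 i ω)
  have hW : ∀ ω, (W ω : ℝ) = ∑ i, x i ω := fun ω => by simp [hWdef, hx]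
  have hM0 : 0 ≤ M := (Real.exp_pos _).le
  have hdiff : ∀ a b, |g a - g b| ≤ 2 * M := fun a b => by
    have := hg a; have := hg b; rw [abs_le] at *; constructor <;> linarith
  -- `W` and `V i` can differ only if an event in the neighborhood of `i` occurs, and then the sum
  -- on the right is at least 1.
  have key1 : ∀ i ω, |g (W ω + 1) - g (V i ω + 1)|
      ≤ 2 * M * ∑ j, if N i j then x j ω else 0 := by
    intro i ω
    by_cases hex : ∃ j, N i j ∧ X j ω
    · obtain ⟨j, hj, hXj⟩ := hex
      refine (hdiff _ _).trans (le_mul_of_one_le_right (by positivity) ?_)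
      have := Finset.single_le_sum (f := fun j => if N i j then x j ω else 0)
        (fun j _ => by split_ifs <;> simp [hx0]) (Finset.mem_univ j)
      simpa [hj, hx, hXj] using this
    · have : W ω = V i ω := by
        simp only [hWdef, hVdef]
        congr 1
        ext j
        simp only [Finset.mem_filter, Finset.mem_univ, true_and]
        exact ⟨fun h => ⟨fun h' => hex ⟨j, h', h⟩, h⟩, fun h => h.2⟩
      rw [this, sub_self, abs_zero]
      refine mul_nonneg (by positivity) (Finset.sum_nonneg fun j _ => ?_)
      split_ifs <;> simp [hx0]
  -- If the event `i` occurs and no other neighbor does, then `W = V i + 1` and the difference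
  -- vanishes.
  have key2 : ∀ i ω, |x i ω * (g (V i ω + 1) - g (W ω))|
      ≤ 2 * M * ∑ j, if N i j ∧ j ≠ i then (if X i ω ∧ X j ω then 1 else 0) else 0 := by
    intro i ω
    have nn : 0 ≤ 2 * M * ∑ j, if N i j ∧ j ≠ i then
        (if X i ω ∧ X j ω then (1 : ℝ) else 0) else 0 := by
      refine mul_nonneg (by positivity) (Finset.sum_nonneg fun j _ => ?_)
      split_ifs <;> simp
    by_cases hi : X i ω
    swap
    · simp [hx, hi]
    by_cases hex : ∃ j, (N i j ∧ j ≠ i) ∧ X j ω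
    · obtain ⟨j, hj, hXj⟩ := hex
      have e : x i ω = 1 := by simp [hx, hi]
      rw [e, one_mul]
      refine (hdiff _ _).trans (le_mul_of_one_le_right (by positivity) ?_)
      have := Finset.single_le_sum (f := fun j => if N i j ∧ j ≠ i then
          (if X i ω ∧ X j ω then (1 : ℝ) else 0) else 0)
        (fun j _ => by split_ifs <;> simp) (Finset.mem_univ j)
      rwa [if_pos hj, if_pos ⟨hi, hXj⟩] at this
    · have : W ω = V i ω + 1 := by
        simp only [hWdef, hVdef]
        rw [← Finset.card_insert_of_notMem (a := i)]
        · congr 1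
          ext j
          simp only [Finset.mem_filter, Finset.mem_univ, true_and, Finset.mem_insert]
          constructor
          · intro h
            by_cases hji : j = i
            · exact Or.inl hji
            · exact Or.inr ⟨fun h' => hex ⟨j, ⟨h', hji⟩, h⟩, h⟩
          · rintro (rfl | h)
            exacts [hi, h.2]
        · simp [hN]
      rw [this, sub_self, mul_zero, abs_zero]
      exact nn
  -- Stein's equation, with `W * g W` split as the sum of `x i * g W`. The inserted terms `p i * g
  -- (V i + 1)` and `x i * g (V i + 1)` have equal means by `hind`.
  have e1 : ∑ ω, w ω * A.indicator 1 (W ω) - (ProbabilityTheory.poissonMeasure r).real A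
      = ∑ i, ∑ ω, w ω * (p i * (g (W ω + 1) - g (V i ω + 1)) +
          x i ω * (g (V i ω + 1) - g (W ω))) := by
    have h1 : ∑ ω, w ω * A.indicator 1 (W ω) - (ProbabilityTheory.poissonMeasure r).real A
        = ∑ ω, w ω * ((r : ℝ) * g (W ω + 1) - W ω * g (W ω)) := by
      simp only [hst, mul_sub, Finset.sum_sub_distrib, ← Finset.sum_mul, hw1, one_mul]
    rw [h1]
    have h2 : ∀ i, ∑ ω, w ω * (p i * (g (W ω + 1) - g (V i ω + 1)) +
          x i ω * (g (V i ω + 1) - g (W ω)))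
        = ∑ ω, w ω * (p i * g (W ω + 1) - x i ω * g (W ω)) := by
      intro i
      have := hind i (fun k => g (k + 1))
      rw [Finset.mul_sum] at this
      rw [← sub_eq_zero] at this ⊢
      rw [← Finset.sum_sub_distrib] at this ⊢
      rw [← this]
      refine Finset.sum_congr rfl fun ω _ => ?_
      simp only [hx, hVdef]
      ring
    rw [Finset.sum_congr rfl fun i _ => h2 i, Finset.sum_comm]
    refine Finset.sum_congr rfl fun ω _ => ?_
    rw [← Finset.mul_sum, Finset.sum_sub_distrib, ← Finset.sum_mul, ← Finset.sum_mul, hr, hW]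
  rw [e1]
  have hterm : ∀ i, |∑ ω, w ω * (p i * (g (W ω + 1) - g (V i ω + 1)) +
      x i ω * (g (V i ω + 1) - g (W ω)))| ≤
      2 * M * ((∑ j, if N i j then p i * p j else 0) +
        ∑ j, if N i j ∧ j ≠ i then ∑ ω, w ω * if X i ω ∧ X j ω then 1 else 0 else 0) := by
    intro i
    have hpt : ∀ ω, |w ω * (p i * (g (W ω + 1) - g (V i ω + 1)) +
        x i ω * (g (V i ω + 1) - g (W ω)))| ≤
        w ω * (p i * (2 * M * ∑ j, if N i j then x j ω else 0) +
         2 * M * ∑ j, if N i j ∧ j ≠ i then (if X i ω ∧ X j ω then 1 else 0) else 0) := by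
      intro ω
      rw [abs_mul, abs_of_nonneg (hw ω)]
      refine mul_le_mul_of_nonneg_left ((abs_add_le _ _).trans (add_le_add ?_ (key2 i ω))) (hw ω)
      rw [abs_mul, abs_of_nonneg (hp0 i)]
      exact mul_le_mul_of_nonneg_left (key1 i ω) (hp0 i)
    refine ((Finset.abs_sum_le_sum_abs _ _).trans (Finset.sum_le_sum fun ω _ => hpt ω)).trans
      (le_of_eq ?_)
    have a1 : (∑ j, if N i j then p i * p j else 0)
        = ∑ ω, w ω * (p i * ∑ j, if N i j then x j ω else 0) := by
      simp only [Finset.mul_sum]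
      rw [Finset.sum_comm]
      refine Finset.sum_congr rfl fun j _ => ?_
      split_ifs
      · rw [hp j, Finset.mul_sum]
        exact Finset.sum_congr rfl fun ω _ => by simp only [hx]; ring
      · simp
    have a2 : (∑ j, if N i j ∧ j ≠ i then ∑ ω, w ω * if X i ω ∧ X j ω then 1 else 0 else 0)
        = ∑ ω, w ω * ∑ j, if N i j ∧ j ≠ i then (if X i ω ∧ X j ω then (1 : ℝ) else 0) else 0 := by
      simp only [Finset.mul_sum]
      rw [Finset.sum_comm]
      refine Finset.sum_congr rfl fun j _ => ?_
      split_ifs <;> simp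
    rw [a1, a2, ← Finset.sum_add_distrib, Finset.mul_sum]
    exact Finset.sum_congr rfl fun ω _ => by ring
  refine ((Finset.abs_sum_le_sum_abs _ _).trans (Finset.sum_le_sum fun i _ => hterm i)).trans
    (le_of_eq ?_)
  rw [← Finset.mul_sum, Finset.sum_add_distrib]

end

/-! ### The uniform measure on rules -/

/-- The probability of a single rule. -/
noncomputable def ruleWeight (n : ℕ) : ℝ := (Fintype.card (Rule n) : ℝ)⁻¹

instance (n : ℕ) : Nonempty (Rule n) := ⟨fun p => p.1⟩

instance (n : ℕ) : IsProbabilityMeasure (ruleMeasure n) :=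
  ProbabilityTheory.isProbabilityMeasure_uniformOn Set.finite_univ Set.univ_nonempty

theorem ruleWeight_nonneg (n : ℕ) : 0 ≤ ruleWeight n := by unfold ruleWeight; positivity

theorem sum_ruleWeight (n : ℕ) : ∑ _f : Rule n, ruleWeight n = 1 := by
  have : (Fintype.card (Rule n) : ℝ) ≠ 0 := by exact_mod_cast Fintype.card_ne_zero
  rw [Finset.sum_const, Finset.card_univ, nsmul_eq_mul, ruleWeight, mul_inv_cancel₀ this]

theorem ruleMeasure_real_singleton {n : ℕ} (f : Rule n) :
    (ruleMeasure n).real {f} = ruleWeight n := by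
  rw [measureReal_def, ruleMeasure, ProbabilityTheory.uniformOn_univ, ruleWeight]
  simp

theorem integral_ruleMeasure {n : ℕ} (F : Rule n → ℝ) :
    ∫ f, F f ∂ruleMeasure n = ∑ f, ruleWeight n * F f := by
  rw [integral_fintype .of_finite]
  simp [ruleMeasure_real_singleton]

open Classical in
theorem ruleMeasure_real {n : ℕ} (s : Set (Rule n)) :
    (ruleMeasure n).real s = ∑ f, ruleWeight n * if f ∈ s then 1 else 0 := by
  rw [← integral_indicator_one .of_discrete, integral_ruleMeasure]
  simp [Set.indicator_apply]

/-! ### Functions with prescribed values -/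

-- Exchanging the values `b` and `v` at the point `a` permutes the functions and does not affect
-- `G`, so all values at `a` carry the same sum.
open Classical in
theorem card_mul_sum_ite_apply_eq {α β : Type*} [Fintype α] [DecidableEq α] [Fintype β]
    (a : α) (v : β)
    (G : (α → β) → ℝ) (hG : ∀ f g : α → β, (∀ x, x ≠ a → f x = g x) → G f = G g) :
    (Fintype.card β : ℝ) * ∑ f : α → β, (if f a = v then G f else 0) = ∑ f, G f := by
  have h1 : ∀ b : β, ∑ f : α → β, (if f a = b then G f else 0)
      = ∑ f : α → β, (if f a = v then G f else 0) := by
    intro b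
    refine Fintype.sum_equiv
      (Equiv.piCongrRight fun x => if x = a then Equiv.swap b v else Equiv.refl β) _ _ fun f => ?_
    have e1 : G ((Equiv.piCongrRight fun x => if x = a then Equiv.swap b v else Equiv.refl β) f)
        = G f := hG _ _ fun x hx => by simp [hx]
    rw [e1]
    congr 1
    simp only [Equiv.piCongrRight_apply, Pi.map_apply, if_true, eq_iff_iff]
    rw [Equiv.swap_apply_eq_iff, Equiv.swap_apply_right]
  calc (Fintype.card β : ℝ) * ∑ f : α → β, (if f a = v then G f else 0)
      = ∑ b : β, ∑ f : α → β, (if f a = b then G f else 0) := by simp [h1]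
    _ = ∑ f, G f := by rw [Finset.sum_comm]; simp

open Classical in
theorem card_pow_mul_sum_ite_eqOn {α β : Type*} [Fintype α] [DecidableEq α] [Fintype β] (v : α → β)
    (K : Finset α) : ∀ (G : (α → β) → ℝ),
    (∀ f g : α → β, (∀ x, x ∉ K → f x = g x) → G f = G g) →
    (Fintype.card β : ℝ) ^ K.card * ∑ f : α → β, (if ∀ a ∈ K, f a = v a then G f else 0)
      = ∑ f, G f := by
  induction K using Finset.induction_on with
  | empty => intro G _; simp
  | insert a K ha ih =>
    intro G hG
    -- The constraint at `a` can be absorbed into `G`: it ignores the values on `K` because `a ∉ K`.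
    have e := ih (fun f => if f a = v a then G f else 0) (by
      intro f g hfg
      have h1 : f a = g a := hfg a ha
      by_cases hfa : f a = v a
      swap
      · simp [← h1, hfa]
      simp only [← h1, hfa, if_true]
      refine hG f g fun x hx => hfg x fun hxK => hx (Finset.mem_insert_of_mem hxK))
    rw [Finset.card_insert_of_notMem ha, pow_succ']
    have h2 : ∀ f : α → β, (if ∀ b ∈ insert a K, f b = v b then G f else 0)
        = if ∀ b ∈ K, f b = v b then (if f a = v a then G f else 0) else 0 := by
      intro f
      rw [← ite_and]
      congr 1
      simp [and_comm]
    simp only [h2]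
    rw [mul_assoc, e]
    exact card_mul_sum_ite_apply_eq a (v a) G fun f g h =>
      hG f g fun x hx => h x fun hxa => hx (hxa ▸ Finset.mem_insert_self a K)

/-! ### Probability of prescribed values of a rule -/

theorem toFinset_range_card {I α : Type*} [Fintype I] [DecidableEq α] (u : I → α) :
    (Finset.univ.image u).card = (Set.range u).ncard := by
  rw [← Set.ncard_coe_finset]; simp

/-- A rule satisfies a consistent family of constraints with probability `n ^ (-m)`, where `m`
is the number of arguments at which its value is prescribed. -/
theorem ruleMeasure_real_constraints {n : ℕ} (hn : 1 ≤ n) {I : Type*} [Fintype I]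
    (κ : I → Fin n × Fin n) (w : I → Fin n) (hf : ∃ f : Rule n, ∀ i, f (κ i) = w i) :
    (ruleMeasure n).real {f | ∀ i, f (κ i) = w i} = ((n : ℝ) ^ (Set.range κ).ncard)⁻¹ := by
  classical
  obtain ⟨f₀, hf₀⟩ := hf
  have h := card_pow_mul_sum_ite_eqOn f₀ (Finset.univ.image κ) (fun _ => (1 : ℝ))
    (fun _ _ _ => rfl)
  rw [toFinset_range_card, Fintype.card_fin] at h
  have h1 : (ruleMeasure n).real {f | ∀ i, f (κ i) = w i} = ruleWeight n *
      ∑ f : Rule n, (if ∀ a ∈ Finset.univ.image κ, f a = f₀ a then (1 : ℝ) else 0) := by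
    rw [ruleMeasure_real, ← Finset.mul_sum]
    congr 1
    refine Finset.sum_congr rfl fun f _ => ?_
    congr 1
    simp [hf₀]
  have h2 : ruleWeight n * ∑ _f : Rule n, (1 : ℝ) = 1 := by
    simp only [Finset.mul_sum, mul_one, sum_ruleWeight]
  have hn0 : (n : ℝ) ^ (Set.range κ).ncard ≠ 0 := by positivity
  rw [h1]
  refine (inv_eq_of_mul_eq_one_right ?_).symm
  rw [mul_left_comm]
  refine (congrArg _ ?_).trans h2
  convert h

theorem ruleMeasure_real_constraints_le {n : ℕ} (hn : 1 ≤ n) {I : Type*} [Fintype I]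
    (κ : I → Fin n × Fin n) (w : I → Fin n) :
    (ruleMeasure n).real {f | ∀ i, f (κ i) = w i} ≤ ((n : ℝ) ^ (Set.range κ).ncard)⁻¹ := by
  by_cases hf : ∃ f : Rule n, ∀ i, f (κ i) = w i
  · exact (ruleMeasure_real_constraints hn κ w hf).le
  · have : {f : Rule n | ∀ i, f (κ i) = w i} = ∅ := by
      ext f; simpa using fun h => hf ⟨f, h⟩
    rw [this, measureReal_empty]
    positivity

open Classical in
/-- The event that a rule satisfies a family of constraints is independent of what depends only
on its values at other arguments. -/
theorem sum_constraints_mul {n : ℕ} (hn : 1 ≤ n) {I : Type*} [Fintype I]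
    (κ : I → Fin n × Fin n) (w : I → Fin n) (G : Rule n → ℝ)
    (hG : ∀ f g : Rule n, (∀ x, x ∉ Set.range κ → f x = g x) → G f = G g) :
    ∑ f, ruleWeight n * ((if ∀ i, f (κ i) = w i then 1 else 0) * G f)
      = (ruleMeasure n).real {f | ∀ i, f (κ i) = w i} * ∑ f, ruleWeight n * G f := by
  by_cases hf : ∃ f : Rule n, ∀ i, f (κ i) = w i
  · rw [ruleMeasure_real_constraints hn κ w hf]
    obtain ⟨f₀, hf₀⟩ := hf
    have h := card_pow_mul_sum_ite_eqOn f₀ (Finset.univ.image κ) G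
      (fun f g h => hG f g fun x hx => h x (by simpa using hx))
    rw [toFinset_range_card, Fintype.card_fin] at h
    have hn0 : (n : ℝ) ^ (Set.range κ).ncard ≠ 0 := by positivity
    rw [eq_inv_mul_iff_mul_eq₀ hn0, ← Finset.mul_sum, ← Finset.mul_sum, ← h]
    rw [mul_left_comm]
    congr 2
    refine Finset.sum_congr rfl fun f _ => ?_
    simp [hf₀]
  · have h1 : ∀ f : Rule n, ¬ ∀ i, f (κ i) = w i := fun f h => hf ⟨f, h⟩
    simp [h1]

/-- The number of maps with a given kernel is at most the number of states raised to the number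
of classes, which bounds the following weighted sum. -/
theorem sum_inv_pow_ncard_range_le {n : ℕ} (hn : 1 ≤ n) (I : Type*) [Fintype I] [DecidableEq I] :
    ∑ u : I → Fin n, ((n : ℝ) ^ (Set.range u).ncard)⁻¹
      ≤ (Fintype.card I : ℝ) ^ Fintype.card I := by
  classical
  -- The map `c` sends each index to a chosen representative of its level set under `u`. There are
  -- at most `|I| ^ |I|` such maps, whatever `n` is.
  have hc : ∀ u : I → Fin n, ∃ c : I → I,
      u ∘ c = u ∧ (Set.range c).ncard = (Set.range u).ncard := by
    intro u
    refine ⟨fun i => (Set.mem_range_self (f := u) i).choose, funext fun i =>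
      (Set.mem_range_self (f := u) i).choose_spec, ?_⟩
    set c : I → I := fun i => (Set.mem_range_self (f := u) i).choose with hcdef
    have hcu : ∀ i, u (c i) = u i := fun i => (Set.mem_range_self (f := u) i).choose_spec
    have himg : u '' Set.range c = Set.range u := by
      rw [← Set.range_comp]; exact congrArg _ (funext hcu)
    rw [← himg, Set.InjOn.ncard_image]
    rintro _ ⟨i, rfl⟩ _ ⟨j, rfl⟩ h
    rw [hcu, hcu] at h
    simp only [hcdef, h]
  calc ∑ u : I → Fin n, ((n : ℝ) ^ (Set.range u).ncard)⁻¹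
      ≤ ∑ u : I → Fin n, ∑ c : I → I,
          if u ∘ c = u then ((n : ℝ) ^ (Set.range c).ncard)⁻¹ else 0 := by
        refine Finset.sum_le_sum fun u _ => ?_
        obtain ⟨c, h1, h2⟩ := hc u
        have := Finset.single_le_sum (f := fun c : I → I =>
            if u ∘ c = u then ((n : ℝ) ^ (Set.range c).ncard)⁻¹ else 0)
          (fun c _ => by split_ifs <;> positivity) (Finset.mem_univ c)
        simpa [h1, h2] using this
    _ = ∑ c : I → I, ((Finset.univ.filter fun u : I → Fin n => u ∘ c = u).card : ℝ) *
          ((n : ℝ) ^ (Set.range c).ncard)⁻¹ := by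
        rw [Finset.sum_comm]
        refine Finset.sum_congr rfl fun c _ => ?_
        rw [← Finset.sum_filter, Finset.sum_const, nsmul_eq_mul]
    _ ≤ ∑ _c : I → I, (1 : ℝ) := by
        refine Finset.sum_le_sum fun c _ => ?_
        rw [mul_inv_le_iff₀ (by positivity), one_mul]
        -- A map with `u ∘ c = u` is determined by its values on the range of `c`.
        have : (Finset.univ.filter fun u : I → Fin n => u ∘ c = u).card
            ≤ Fintype.card (Set.range c → Fin n) := by
          rw [← Finset.card_univ]
          refine Finset.card_le_card_of_injOn (fun u x => u x.1)
            (fun _ _ => Finset.mem_coe.2 (Finset.mem_univ _)) ?_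
          intro u hu v hv huv
          simp only [Finset.coe_filter, Finset.mem_univ, true_and, Set.mem_ofPred_eq] at hu hv
          rw [← hu, ← hv]
          funext i
          exact congrFun huv ⟨c i, i, rfl⟩
        rw [Fintype.card_fun, Fintype.card_fin, ← Nat.card_eq_fintype_card,
          Nat.card_coe_set_eq] at this
        exact_mod_cast this
    _ = (Fintype.card I : ℝ) ^ Fintype.card I := by simp

/-! ### Blocks of periodic solutions -/

/-- The rule `f` produces the block `A`. -/
def Block.Sat {n τ σ : ℕ} (f : Rule n) (A : Block n τ σ) : Prop :=
  ∀ p : ZMod τ × ZMod σ, f (A p.1 p.2, A p.1 (p.2 + 1)) = A (p.1 + 1) (p.2 + 1)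

/-- The block has no proper translational symmetry along either axis. -/
def Block.Free {n τ σ : ℕ} (A : Block n τ σ) : Prop :=
  (∀ v : ZMod σ, (∀ i j, A i (j + v) = A i j) → v = 0) ∧
    ∀ u : ZMod τ, (∀ i j, A (i + u) j = A i j) → u = 0

theorem Block.Sat.of_rotation {n τ σ : ℕ} {f : Rule n} {A B : Block n τ σ}
    (h : (rotation n τ σ).r A B) (hA : A.Sat f) : B.Sat f := by
  obtain ⟨u, v, h⟩ := h
  intro p
  have := hA (p.1 + u, p.2 + v)
  simp only [h]
  rw [add_right_comm p.2 1 v, add_right_comm p.1 1 u]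
  exact this

theorem Block.Free.of_rotation {n τ σ : ℕ} {A B : Block n τ σ}
    (h : (rotation n τ σ).r A B) (hA : A.Free) : B.Free := by
  obtain ⟨u, v, h⟩ := h
  constructor
  · intro v' hv
    refine hA.1 v' fun i j => ?_
    have := hv (i - u) (j - v)
    rw [h, h] at this
    convert this using 2 <;> ring
  · intro u' hu
    refine hA.2 u' fun i j => ?_
    have := hu (i - u) (j - v)
    rw [h, h] at this
    convert this using 2 <;> ring

/-- The dynamics is deterministic and commutes with translations, so a coincidence of two rows up to
a shift persists in all later rows. -/
theorem Block.Sat.shift {n τ σ : ℕ} {f : Rule n} {A : Block n τ σ} (hA : A.Sat f)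
    {i i' : ZMod τ} {v : ZMod σ} (h : ∀ j, A i (j + v) = A i' j) (k : ℕ) :
    ∀ j, A (i + k) (j + v) = A (i' + k) j := by
  induction k with
  | zero => simpa using h
  | succ k ih =>
    intro j
    have h1 := hA (i + k, j - 1 + v)
    have h2 := hA (i' + k, j - 1)
    have e : j - 1 + v + 1 = j + v := by ring
    simp only [e, sub_add_cancel] at h1 h2
    rw [ih j, ih (j - 1), h2] at h1
    push_cast
    rw [← add_assoc, ← add_assoc]
    exact h1.symm

theorem traj_succ {n : ℕ} (f : Rule n) (ξ : Config n) (t : ℕ) (x : ℤ) :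
    traj f ξ (t + 1) x = f (traj f ξ t (x - 1), traj f ξ t x) := by
  rw [traj, Function.iterate_succ_apply']; rfl

theorem HasPeriods.traj_val {n : ℕ} {f : Rule n} {τ σ : ℕ} [NeZero σ] {ξ : Config n}
    (h : HasPeriods f τ σ ξ) (t : ℕ) (x : ℤ) :
    traj f ξ (t : ZMod τ).val (x : ZMod σ).val = traj f ξ t x := by
  have hx : ∀ t, Function.Periodic (traj f ξ t) (σ : ℤ) := by
    intro t
    induction t with
    | zero => exact h.1.1.2
    | succ t ih =>
      intro x
      rw [traj_succ, traj_succ, ih x, add_sub_right_comm, ih]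
  have ht : Function.Periodic (traj f ξ) τ := by
    intro t
    have : traj f ξ τ = ξ := funext h.2.1.2
    rw [traj, Function.iterate_add_apply]
    exact congrArg _ this
  rw [ZMod.val_natCast, ht.map_mod_nat, ZMod.val_intCast, Int.emod_def, mul_comm]
  have := (hx t).sub_zsmul_eq (x / σ) (x := x)
  simpa using this

/-- This replaces trajectories on `ℤ` by finite conditions on the torus. By determinism, a period
visible in row 0 is a symmetry of the whole block, so minimality of both periods amounts to `Free`.
-/
theorem mk_mem_periodicSolutions {n τ σ : ℕ} [NeZero τ] [NeZero σ] (f : Rule n)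
    (A : Block n τ σ) :
    (Quotient.mk (rotation n τ σ) A : Tile n τ σ) ∈ periodicSolutions τ σ f
      ↔ A.Sat f ∧ A.Free := by
  constructor
  · rintro ⟨ξ, hξ, hT⟩
    set B : Block n τ σ := fun i j => traj f ξ i.val (j.val : ℤ) with hB
    have hrel : (rotation n τ σ).r B A := Quotient.exact hT
    have hBt : ∀ (t : ℕ) (x : ℤ), B t x = traj f ξ t x := fun t x => hξ.traj_val t x
    refine ⟨Block.Sat.of_rotation hrel ?_, Block.Free.of_rotation hrel ⟨?_, ?_⟩⟩
    · rintro ⟨i, j⟩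
      obtain ⟨t, rfl⟩ : ∃ t : ℕ, (t : ZMod τ) = i := ⟨i.val, ZMod.natCast_zmod_val i⟩
      obtain ⟨x, rfl⟩ : ∃ x : ℤ, (x : ZMod σ) = j := ⟨j.val, by simp⟩
      have h1 := hBt t (x + 1)
      have h2 := hBt (t + 1) (x + 1)
      rw [traj_succ, add_sub_cancel_right] at h2
      push_cast at h1 h2
      simp only [h1, h2, hBt]
    · intro v hv
      by_contra hv0
      have hpos : 0 < v.val := Nat.pos_of_ne_zero fun h => hv0 ((ZMod.val_eq_zero v).1 h)
      refine absurd (hξ.1.2 ⟨hpos, fun x => ?_⟩) (not_le.2 (ZMod.val_lt v))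
      have h1 := hBt 0 (x + v.val)
      have h2 := hBt 0 x
      push_cast [ZMod.natCast_zmod_val] at h1 h2
      rw [hv, h2] at h1
      exact h1.symm
    · intro u hu
      by_contra hu0
      have hpos : 0 < u.val := Nat.pos_of_ne_zero fun h => hu0 ((ZMod.val_eq_zero u).1 h)
      refine absurd (hξ.2.2 ⟨hpos, fun x => ?_⟩) (not_le.2 (ZMod.val_lt u))
      have h1 := hBt u.val x
      have h2 := hBt 0 x
      have h3 := hu 0 (x : ZMod σ)
      rw [ZMod.natCast_zmod_val] at h1
      rw [Nat.cast_zero] at h2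
      rw [zero_add] at h3
      rw [← h1, h3, h2]
      rfl
  · rintro ⟨hS, hF⟩
    set ξ : Config n := fun x => A 0 x with hξ
    have htr : ∀ (t : ℕ) (x : ℤ), traj f ξ t x = A t x := by
      intro t
      induction t with
      | zero => intro x; simp [traj, hξ]
      | succ t ih =>
        intro x
        have := hS (t, (x : ZMod σ) - 1)
        rw [traj_succ, ih, ih]
        push_cast
        simpa using this
    refine ⟨ξ, ⟨⟨⟨NeZero.pos σ, fun x => by simp [hξ]⟩, ?_⟩,
      ⟨NeZero.pos τ, fun x => by rw [htr]; simp [hξ]⟩, ?_⟩, ?_⟩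
    · rintro s ⟨hs, hper⟩
      -- Any period `s` gives a symmetry, which freeness makes trivial; hence `σ ∣ s`.
      refine Nat.le_of_dvd hs ((ZMod.natCast_eq_zero_iff s σ).1 (hF.1 _ fun i j => ?_))
      have h0 : ∀ j : ZMod σ, A 0 (j + s) = A 0 j := by
        intro j
        obtain ⟨x, rfl⟩ : ∃ x : ℤ, (x : ZMod σ) = j := ⟨j.val, by simp⟩
        simpa [hξ] using hper x
      simpa using hS.shift h0 i.val j
    · rintro s ⟨hs, hper⟩
      refine Nat.le_of_dvd hs ((ZMod.natCast_eq_zero_iff s τ).1 (hF.2 _ fun i j => ?_))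
      have h0 : ∀ j : ZMod σ, A s (j + 0) = A 0 j := by
        intro j
        obtain ⟨x, rfl⟩ : ∃ x : ℤ, (x : ZMod σ) = j := ⟨j.val, by simp⟩
        rw [add_zero, ← htr]
        exact hper x
      simpa [add_comm] using hS.shift h0 i.val j
    · refine congrArg _ (funext fun i => funext fun j => ?_)
      rw [htr]
      simp

/-! ### States, assignments and excess -/

theorem ncard_range_fst_le {I α β : Type*} [Finite I] (κ : I → α × β) :
    (Set.range fun i => (κ i).1).ncard ≤ (Set.range κ).ncard := by
  have : (Set.range fun i => (κ i).1) = Prod.fst '' Set.range κ := by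
    rw [← Set.range_comp]; rfl
  rw [this]
  exact Set.ncard_image_le (Set.finite_range κ)

/-- A map of a finite set that does not lower its cardinality is injective on it. Applied to
adjacent pairs, this says that at lag 0 a state determines its right neighbor. -/
theorem eq_of_ncard_range_fst_eq {I α β : Type*} [Finite I] {κ : I → α × β}
    (h : (Set.range κ).ncard ≤ (Set.range fun i => (κ i).1).ncard) {i j : I}
    (hij : (κ i).1 = (κ j).1) : κ i = κ j := by
  have e : (Set.range fun i => (κ i).1) = Prod.fst '' Set.range κ := by
    rw [← Set.range_comp]; rfl
  rw [e] at h
  exact Set.injOn_of_ncard_image_eq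
    (le_antisymm (Set.ncard_image_le (Set.finite_range κ)) h) (Set.finite_range κ)
    (Set.mem_range_self i) (Set.mem_range_self j) hij

section

variable {n τ σ : ℕ}

/-- A block as a function on the discrete torus. -/
def Block.states (A : Block n τ σ) (p : ZMod τ × ZMod σ) : Fin n := A p.1 p.2

/-- The horizontally adjacent pairs of a block. -/
def Block.pairs (A : Block n τ σ) (p : ZMod τ × ZMod σ) : Fin n × Fin n :=
  (A p.1 p.2, A p.1 (p.2 + 1))

variable [NeZero τ] [NeZero σ]

theorem Block.numStates_le_numAssignments (A : Block n τ σ) :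
    A.numStates ≤ A.numAssignments :=
  ncard_range_fst_le A.pairs

/-- If, in two blocks of the same rule, equal states always have equal right neighbors, then the
blocks are rotations of each other as soon as they share a state. -/
theorem Block.Sat.states_add_eq {f : Rule n} {A B : Block n τ σ} (hA : A.Sat f) (hB : B.Sat f)
    (hdet : ∀ p q, A.states p = B.states q → A.pairs p = B.pairs q)
    {p q : ZMod τ × ZMod σ} (hpq : A.states p = B.states q) (r : ZMod τ × ZMod σ) :
    A.states (p + r) = B.states (q + r) := by
  have hright : ∀ (k : ℕ) (p q : ZMod τ × ZMod σ), A.states p = B.states q →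
      A.states (p + k • (0, 1)) = B.states (q + k • (0, 1)) := by
    intro k
    induction k with
    | zero => intro p q h; simpa using h
    | succ k ih =>
      intro p q h
      rw [succ_nsmul', ← add_assoc, ← add_assoc]
      apply ih
      simpa [Block.states, Block.pairs] using congrArg Prod.snd (hdet p q h)
  -- Equal pairs receive equal images under the rule, and the image sits one step down and one step
  -- right.
  have hdiag : ∀ (k : ℕ) (p q : ZMod τ × ZMod σ), A.states p = B.states q →
      A.states (p + k • (1, 1)) = B.states (q + k • (1, 1)) := by
    intro k
    induction k with
    | zero => intro p q h; simpa using h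
    | succ k ih =>
      intro p q h
      rw [succ_nsmul', ← add_assoc, ← add_assoc]
      apply ih
      have := hdet p q h
      have h1 := hA p
      have h2 := hB q
      simp only [Block.pairs] at this
      rw [this, h2] at h1
      exact h1.symm
  -- Diagonal and right steps together reach every point of the torus.
  have hr : r = r.1.val • (1, 1) + (r.2 - r.1.val).val • ((0, 1) : ZMod τ × ZMod σ) := by
    ext <;> simp
  rw [hr, ← add_assoc, ← add_assoc]
  exact hright _ _ _ (hdiag _ _ _ hpq)

/-- The event that a rule produces a block has probability at most `n ^ (-m)`, where `m` is the
number of assignments. -/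
theorem real_sat_le (hn : 1 ≤ n) (A : Block n τ σ) :
    (ruleMeasure n).real {f | A.Sat f} ≤ ((n : ℝ) ^ A.numAssignments)⁻¹ :=
  ruleMeasure_real_constraints_le hn A.pairs fun p => A (p.1 + 1) (p.2 + 1)

theorem real_sat (hn : 1 ≤ n) (A : Block n τ σ) (hA : ∃ f, A.Sat f) :
    (ruleMeasure n).real {f | A.Sat f} = ((n : ℝ) ^ A.numAssignments)⁻¹ :=
  ruleMeasure_real_constraints hn A.pairs (fun p => A (p.1 + 1) (p.2 + 1)) hA

/-- Two distinct tiles with a common state that are produced by the same rule require more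
assignments than they have states. -/
theorem real_sat_sat_le (hn : 1 ≤ n) (A B : Block n τ σ) (hAB : ¬ (rotation n τ σ).r A B)
    (hsh : ∃ p q, A.states p = B.states q) :
    (ruleMeasure n).real {f | A.Sat f ∧ B.Sat f} ≤
      (n : ℝ)⁻¹ * ((n : ℝ) ^ (Set.range (Sum.elim A.states B.states)).ncard)⁻¹ := by
  by_cases hf : ∃ f : Rule n, A.Sat f ∧ B.Sat f
  swap
  · have : {f : Rule n | A.Sat f ∧ B.Sat f} = ∅ := by
      ext f; simpa using fun h h' => hf ⟨f, h, h'⟩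
    rw [this, measureReal_empty]
    positivity
  obtain ⟨f, hfA, hfB⟩ := hf
  set κ := Sum.elim A.pairs B.pairs with hκ
  have hst : Sum.elim A.states B.states = fun i => (κ i).1 := by
    funext i; cases i <;> rfl
  -- Otherwise a state determines its right neighbor across both blocks, and the common state makes
  -- one block a rotation of the other.
  have hlt : (Set.range (Sum.elim A.states B.states)).ncard + 1 ≤ (Set.range κ).ncard := by
    by_contra hcon
    rw [Nat.succ_le_iff, not_lt, hst] at hcon
    obtain ⟨p, q, hpq⟩ := hsh
    have hadd := hfA.states_add_eq hfB (fun p q h => by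
      have := eq_of_ncard_range_fst_eq hcon (i := Sum.inl p) (j := Sum.inr q) h
      simpa [hκ] using this) hpq
    refine hAB ⟨p.1 - q.1, p.2 - q.2, fun i j => ?_⟩
    have := hadd ((i, j) - q)
    rw [add_sub_cancel] at this
    refine this.symm.trans ?_
    simp only [Block.states, Prod.fst_add, Prod.snd_add, Prod.fst_sub, Prod.snd_sub]
    congr 1 <;> ring
  have h1 := ruleMeasure_real_constraints_le hn κ
    (Sum.elim (fun p => A (p.1 + 1) (p.2 + 1)) fun p => B (p.1 + 1) (p.2 + 1))
  have h2 : {f : Rule n | A.Sat f ∧ B.Sat f} = {f | ∀ i, f (κ i) =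
      Sum.elim (fun p => A (p.1 + 1) (p.2 + 1)) (fun p => B (p.1 + 1) (p.2 + 1)) i} := by
    ext f
    simp only [Set.mem_ofPred_eq, Sum.forall]
    rfl
  rw [h2]
  refine h1.trans ?_
  rw [← mul_inv, ← pow_succ']
  have : (1 : ℝ) ≤ n := by exact_mod_cast hn
  gcongr

theorem ncard_range_elim_lt (A B : Block n τ σ) (hsh : ∃ p q, A.states p = B.states q) :
    (Set.range (Sum.elim A.states B.states)).ncard + 1 ≤ A.numStates + B.numStates := by
  have h := Set.ncard_union_add_ncard_inter (Set.range A.states) (Set.range B.states)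
  obtain ⟨p, q, hpq⟩ := hsh
  have h1 : 0 < (Set.range A.states ∩ Set.range B.states).ncard :=
    (Set.ncard_pos).2 ⟨_, ⟨p, rfl⟩, ⟨q, hpq.symm⟩⟩
  rw [Set.Sum.elim_range]
  have h2 : A.numStates = (Set.range A.states).ncard := rfl
  have h3 : B.numStates = (Set.range B.states).ncard := rfl
  omega

/-! ### Simple blocks and subgroups of the torus -/

/-- The subgroup meets both axes trivially. -/
def AxisFree (H : AddSubgroup (ZMod τ × ZMod σ)) : Prop :=
  (∀ v, ((0, v) : ZMod τ × ZMod σ) ∈ H → v = 0) ∧ ∀ u, ((u, 0) : ZMod τ × ZMod σ) ∈ H → u = 0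

/-- The level sets of the block are the cosets of `H`. -/
def Block.HasKernel (A : Block n τ σ) (H : AddSubgroup (ZMod τ × ZMod σ)) : Prop :=
  ∀ p q, A.states p = A.states q ↔ p - q ∈ H

/-- The group of translational symmetries of a block. -/
def Block.symmetries (A : Block n τ σ) : AddSubgroup (ZMod τ × ZMod σ) where
  carrier := {r | ∀ p, A.states (p + r) = A.states p}
  zero_mem' := fun p => by simp
  add_mem' := fun {a b} ha hb p => by rw [← add_assoc, hb, ha]
  neg_mem' := fun {a} ha p => by rw [← ha (p + -a), neg_add_cancel_right]

/-- The block belongs to a simple periodic solution of some rule. -/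
def Block.IsSimple (A : Block n τ σ) : Prop :=
  (∃ f, A.Sat f) ∧ A.Free ∧ A.numAssignments = A.numStates

/-- Forward, `H` is the symmetry group: at lag 0 a single coincidence of states propagates to a
translational symmetry. Backward, level sets that are cosets make the right and the diagonal
neighbor functions of the state, which gives both a rule and lag 0. -/
theorem Block.isSimple_iff (A : Block n τ σ) :
    A.IsSimple ↔ ∃ H, AxisFree H ∧ A.HasKernel H := by
  constructor
  · rintro ⟨⟨f, hf⟩, hF, hlag⟩
    refine ⟨A.symmetries, ⟨fun v hv => hF.1 v fun i j => ?_, fun u hu => hF.2 u fun i j => ?_⟩,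
      fun p q => ⟨fun h x => ?_, fun h => ?_⟩⟩
    · simpa [Block.states] using hv (i, j)
    · simpa [Block.states] using hu (i, j)
    · have := hf.states_add_eq hf (fun p q h => eq_of_ncard_range_fst_eq
        (κ := A.pairs) hlag.le h) h (x - q)
      rw [add_sub_cancel] at this
      rw [← this]
      congr 1
      abel
    · have := h q
      rwa [add_sub_cancel] at this
  · rintro ⟨H, hH, hK⟩
    have hshift : ∀ p q r, A.states p = A.states q → A.states (p + r) = A.states (q + r) := by
      intro p q r h
      rw [hK] at h ⊢
      simpa using h
    have hdet : ∀ p q, A.states p = A.states q → A.pairs p = A.pairs q := by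
      intro p q h
      have := hshift p q (0, 1) h
      simp only [Block.states, Prod.fst_add, Prod.snd_add, add_zero] at h this
      simp only [Block.pairs, h, this]
    -- Outside the pairs of the block the rule is arbitrary; `x.1` is a filler.
    refine ⟨⟨Function.extend A.pairs (fun p => A (p.1 + 1) (p.2 + 1)) fun x => x.1, fun p => ?_⟩,
      ⟨fun v hv => hH.1 v ?_, fun u hu => hH.2 u ?_⟩, le_antisymm ?_ A.numStates_le_numAssignments⟩
    · refine Function.FactorsThrough.extend_apply (f := A.pairs) ?_ _ p
      intro p q h
      exact hshift p q (1, 1) (congrArg Prod.fst h)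
    · have := (hK (0, v) 0).1 (by simpa [Block.states] using hv 0 0)
      rwa [sub_zero] at this
    · have := (hK (u, 0) 0).1 (by simpa [Block.states] using hu 0 0)
      rwa [sub_zero] at this
    · have e : Set.range A.states = Prod.fst '' Set.range A.pairs := by
        rw [← Set.range_comp]; rfl
      have : (Set.range A.states).ncard = (Set.range A.pairs).ncard := by
        rw [e, Set.InjOn.ncard_image]
        rintro _ ⟨p, rfl⟩ _ ⟨q, rfl⟩ h
        exact hdet p q h
      exact this.symm.le

omit [NeZero τ] [NeZero σ] in
theorem Block.HasKernel.unique {A : Block n τ σ} {H H' : AddSubgroup (ZMod τ × ZMod σ)}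
    (h : A.HasKernel H) (h' : A.HasKernel H') : H = H' := by
  ext r
  have h1 := h r 0
  have h2 := h' r 0
  rw [sub_zero] at h1 h2
  exact h1.symm.trans h2

/-- Blocks with kernel `H` are injections of the quotient by `H` into the states. -/
noncomputable def kernelEquiv (n : ℕ) (H : AddSubgroup (ZMod τ × ZMod σ)) :
    {A : Block n τ σ // A.HasKernel H} ≃ (((ZMod τ × ZMod σ) ⧸ H) ↪ Fin n) where
  toFun A := ⟨Quotient.lift A.1.states fun p q h => (A.2 p q).2 (by
      rw [← neg_mem_iff, neg_sub, sub_eq_neg_add]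
      exact QuotientAddGroup.leftRel_apply.1 h), by
      rintro ⟨p⟩ ⟨q⟩ h
      have := (A.2 p q).1 h
      refine QuotientAddGroup.eq.2 ?_
      rwa [← sub_eq_neg_add, ← neg_sub, neg_mem_iff]⟩
  invFun e := ⟨fun i j => e (QuotientAddGroup.mk (i, j)), fun p q => by
    simp only [Block.states, Prod.mk.eta, EmbeddingLike.apply_eq_iff_eq]
    rw [QuotientAddGroup.eq, ← sub_eq_neg_add, ← neg_sub, neg_mem_iff]⟩
  left_inv A := rfl
  right_inv e := by
    ext ⟨p⟩
    rfl

theorem card_hasKernel (n : ℕ) (H : AddSubgroup (ZMod τ × ZMod σ)) :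
    Nat.card {A : Block n τ σ // A.HasKernel H}
      = n.descFactorial (Nat.card ((ZMod τ × ZMod σ) ⧸ H)) := by
  classical
  have := Fintype.ofFinite ((ZMod τ × ZMod σ) ⧸ H)
  rw [Nat.card_congr (kernelEquiv n H), Nat.card_eq_fintype_card, Fintype.card_embedding_eq,
    Fintype.card_fin, Nat.card_eq_fintype_card]

omit [NeZero τ] [NeZero σ] in
theorem Block.HasKernel.numStates_eq {A : Block n τ σ} {H : AddSubgroup (ZMod τ × ZMod σ)}
    (h : A.HasKernel H) : A.numStates = Nat.card ((ZMod τ × ZMod σ) ⧸ H) := by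
  have hr : Set.range A.states = Set.range (kernelEquiv n H ⟨A, h⟩) := by
    ext x
    constructor
    · rintro ⟨p, rfl⟩
      exact ⟨QuotientAddGroup.mk p, rfl⟩
    · rintro ⟨⟨p⟩, rfl⟩
      exact ⟨p, rfl⟩
  have : A.numStates = (Set.range A.states).ncard := rfl
  rw [this, hr, ← Nat.card_coe_set_eq]
  exact Nat.card_range_of_injective (kernelEquiv n H ⟨A, h⟩).injective

omit [NeZero τ] [NeZero σ] in
/-- A simple block has as many rotations as it has states. -/
theorem Block.HasKernel.ncard_rotations {A : Block n τ σ} {H : AddSubgroup (ZMod τ × ZMod σ)}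
    (h : A.HasKernel H) : {B | (rotation n τ σ).r A B}.ncard = A.numStates := by
  -- A rotation of `A` is determined by its entry at the origin, and every state of `A` occurs as
  -- such an entry.
  have hr : Set.range A.states =
      (fun B : Block n τ σ => B 0 0) '' {B | (rotation n τ σ).r A B} := by
    ext x
    constructor
    · rintro ⟨p, rfl⟩
      exact ⟨fun i j => A (i + p.1) (j + p.2), ⟨p.1, p.2, fun i j => rfl⟩, by simp [Block.states]⟩
    · rintro ⟨B, ⟨u, v, hB⟩, rfl⟩
      exact ⟨(u, v), by simp [Block.states, hB]⟩
  have : A.numStates = (Set.range A.states).ncard := rfl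
  rw [this, hr, Set.InjOn.ncard_image]
  rintro B ⟨u, v, hB⟩ C ⟨u', v', hC⟩ hBC
  simp only [hB, hC, zero_add] at hBC
  have h0 := (h (u, v) (u', v')).1 hBC
  funext i j
  rw [hB, hC]
  exact (h (i + u, j + v) (i + u', j + v')).2 (by simpa using h0)

end

/-! ### Counting the subgroups that meet the axes trivially -/

section

variable {τ σ : ℕ} [NeZero τ] [NeZero σ] {H : AddSubgroup (ZMod τ × ZMod σ)}

-- The kernel of the first projection on `H` is the intersection of `H` with the second axis.
omit [NeZero τ] [NeZero σ] in
theorem AxisFree.injective_fst (hH : AxisFree H) :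
    Function.Injective ((AddMonoidHom.fst (ZMod τ) (ZMod σ)).comp H.subtype) := by
  rw [injective_iff_map_eq_zero]
  rintro ⟨⟨u, v⟩, h⟩ h0
  obtain rfl : u = 0 := h0
  obtain rfl := hH.1 v h
  rfl

omit [NeZero τ] [NeZero σ] in
theorem AxisFree.injective_snd (hH : AxisFree H) :
    Function.Injective ((AddMonoidHom.snd (ZMod τ) (ZMod σ)).comp H.subtype) := by
  rw [injective_iff_map_eq_zero]
  rintro ⟨⟨u, v⟩, h⟩ h0
  obtain rfl : v = 0 := h0
  obtain rfl := hH.2 u h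
  rfl

theorem AxisFree.card_dvd_gcd (hH : AxisFree H) : Nat.card H ∣ Nat.gcd τ σ := by
  refine Nat.dvd_gcd ?_ ?_
  · simpa using AddSubgroup.card_dvd_of_injective _ hH.injective_fst
  · simpa using AddSubgroup.card_dvd_of_injective _ hH.injective_snd

open Classical in
theorem card_filter_addOrderOf {d : ℕ} (n : ℕ) [NeZero n] (hd : d ∣ n) :
    (Finset.univ.filter fun x : ZMod n => addOrderOf x = d).card = d.totient :=
  IsAddCyclic.card_addOrderOf_eq_totient (by rwa [ZMod.card])

-- As both coordinates have order `d`, a multiple of `g` vanishes in one coordinate exactly when it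
-- vanishes in the other.
omit [NeZero τ] [NeZero σ] in
theorem mem_of_addOrderOf_eq {g : ZMod τ × ZMod σ} {d : ℕ} (h1 : addOrderOf g.1 = d)
    (h2 : addOrderOf g.2 = d) :
    AxisFree (AddSubgroup.zmultiples g) ∧ Nat.card (AddSubgroup.zmultiples g) = d := by
  refine ⟨⟨fun v hv => ?_, fun u hu => ?_⟩, ?_⟩
  · obtain ⟨k, hk⟩ := AddSubgroup.mem_zmultiples_iff.1 hv
    have e1 : k • g.1 = 0 := congrArg Prod.fst hk
    have e2 : k • g.2 = v := congrArg Prod.snd hk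
    rw [← addOrderOf_dvd_iff_zsmul_eq_zero, h1, ← h2, addOrderOf_dvd_iff_zsmul_eq_zero] at e1
    exact e2.symm.trans e1
  · obtain ⟨k, hk⟩ := AddSubgroup.mem_zmultiples_iff.1 hu
    have e1 : k • g.1 = u := congrArg Prod.fst hk
    have e2 : k • g.2 = 0 := congrArg Prod.snd hk
    rw [← addOrderOf_dvd_iff_zsmul_eq_zero, h2, ← h1, addOrderOf_dvd_iff_zsmul_eq_zero] at e2
    exact e1.symm.trans e2
  · rw [Nat.card_zmultiples, Prod.addOrderOf, h1, h2, Nat.lcm_self]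

open Classical in
/-- A subgroup of order `d` that meets the axes trivially is cyclic, and its generators are its
elements whose coordinates both have order `d`. -/
theorem AxisFree.card_generators (hH : AxisFree H) :
    (Finset.univ.filter fun g : ZMod τ × ZMod σ =>
      (addOrderOf g.1 = Nat.card H ∧ addOrderOf g.2 = Nat.card H) ∧
        AddSubgroup.zmultiples g = H).card = (Nat.card H).totient := by
  have : IsAddCyclic H := isAddCyclic_of_injective _ hH.injective_fst
  have := Fintype.ofFinite H
  have h := IsAddCyclic.card_addOrderOf_eq_totient (α := H) (d := Nat.card H)
    (by rw [Nat.card_eq_fintype_card])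
  rw [← h]
  symm
  refine Finset.card_bij (fun g _ => g.1) ?_ (fun _ _ _ _ h => Subtype.ext h) ?_
  · intro g hg
    simp only [Finset.mem_filter, Finset.mem_univ, true_and] at hg ⊢
    refine ⟨⟨?_, ?_⟩, ?_⟩
    · rw [← hg]
      exact addOrderOf_injective ((AddMonoidHom.fst (ZMod τ) (ZMod σ)).comp H.subtype)
        hH.injective_fst g
    · rw [← hg]
      exact addOrderOf_injective ((AddMonoidHom.snd (ZMod τ) (ZMod σ)).comp H.subtype)
        hH.injective_snd g
    · refine AddSubgroup.eq_of_le_of_card_ge ?_ ?_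
      · rw [AddSubgroup.zmultiples_le]
        exact g.2
      · rw [Nat.card_zmultiples, AddSubgroup.addOrderOf_coe, hg]
  · intro g hg
    simp only [Finset.mem_filter, Finset.mem_univ, true_and] at hg
    have hgH : g ∈ H := by
      have := AddSubgroup.mem_zmultiples g
      rwa [hg.2] at this
    refine ⟨⟨g, hgH⟩, ?_, rfl⟩
    simp only [Finset.mem_filter, Finset.mem_univ, true_and]
    rw [← AddSubgroup.addOrderOf_coe, ← Nat.card_zmultiples, hg.2]

-- Double counting: `φ(d) ^ 2` elements have both coordinates of order `d`, each generates a
-- subgroup of the required kind, and each such subgroup has `φ(d)` of them as generators.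
open Classical in
theorem card_axisFree [Fintype (AddSubgroup (ZMod τ × ZMod σ))] {d : ℕ}
    (hd : d ∣ Nat.gcd τ σ) :
    (Finset.univ.filter fun H : AddSubgroup (ZMod τ × ZMod σ) =>
      AxisFree H ∧ Nat.card H = d).card = d.totient := by
  have hd0 : 0 < d := Nat.pos_of_dvd_of_pos hd (Nat.gcd_pos_of_pos_left _ (NeZero.pos τ))
  have h1 : (Finset.univ.filter fun g : ZMod τ × ZMod σ =>
      addOrderOf g.1 = d ∧ addOrderOf g.2 = d).card = d.totient * d.totient := by
    rw [← Finset.univ_product_univ, Finset.filter_product (fun x : ZMod τ => addOrderOf x = d)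
      (fun y : ZMod σ => addOrderOf y = d), Finset.card_product,
      card_filter_addOrderOf τ (hd.trans (Nat.gcd_dvd_left _ _)),
      card_filter_addOrderOf σ (hd.trans (Nat.gcd_dvd_right _ _))]
  have h2 := Finset.card_eq_sum_card_fiberwise (f := AddSubgroup.zmultiples)
    (s := Finset.univ.filter fun g : ZMod τ × ZMod σ => addOrderOf g.1 = d ∧ addOrderOf g.2 = d)
    (t := Finset.univ.filter fun H : AddSubgroup (ZMod τ × ZMod σ) => AxisFree H ∧ Nat.card H = d)
    (by
      intro g hg
      simp only [Finset.coe_filter, Finset.mem_univ, true_and, Set.mem_ofPred_eq] at hg ⊢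
      exact mem_of_addOrderOf_eq hg.1 hg.2)
  rw [Finset.sum_congr rfl (g := fun _ => d.totient), Finset.sum_const, h1, smul_eq_mul] at h2
  · exact (Nat.eq_of_mul_eq_mul_right (Nat.totient_pos.2 hd0) h2).symm
  · intro H hH
    simp only [Finset.mem_filter, Finset.mem_univ, true_and] at hH
    obtain ⟨hH, rfl⟩ := hH
    rw [Finset.filter_filter]
    exact hH.card_generators

open Classical in
theorem sum_card_axisFree [Fintype (AddSubgroup (ZMod τ × ZMod σ))] :
    ∑ H : AddSubgroup (ZMod τ × ZMod σ), (if AxisFree H then Nat.card H else 0)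
      = ∑ d ∈ (Nat.gcd τ σ).divisors, d.totient * d := by
  have hg : Nat.gcd τ σ ≠ 0 := (Nat.gcd_pos_of_pos_left _ (NeZero.pos τ)).ne'
  rw [← Finset.sum_filter]
  refine (Finset.sum_fiberwise_of_maps_to (t := (Nat.gcd τ σ).divisors)
    (g := fun H : AddSubgroup (ZMod τ × ZMod σ) => Nat.card H) ?_ _).symm.trans ?_
  rotate_left
  · refine Finset.sum_congr rfl fun d hd => ?_
    rw [Finset.filter_filter, Finset.sum_congr rfl (g := fun _ => d), Finset.sum_const,
      smul_eq_mul, card_axisFree (Nat.dvd_of_mem_divisors hd)]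
    intro H hH
    simp only [Finset.mem_filter, Finset.mem_univ, true_and] at hH
    exact hH.2
  · intro H hH
    simp only [Finset.mem_filter, Finset.mem_univ, true_and] at hH
    exact Nat.mem_divisors.2 ⟨hH.card_dvd_gcd, hg⟩

-- Since `τ σ` is `|H|` times the index of `H`, the weight `|H| / (τ σ)` is the inverse index, which
-- is the form in which `simpleMean_eq` produces the limit.
open Classical in
theorem lam_eq_sum [Fintype (AddSubgroup (ZMod τ × ZMod σ))] :
    lam τ σ = ∑ H : AddSubgroup (ZMod τ × ZMod σ),
      if AxisFree H then ((Nat.card ((ZMod τ × ZMod σ) ⧸ H) : ℝ))⁻¹ else 0 := by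
  have h := sum_card_axisFree (τ := τ) (σ := σ)
  have h' := congrArg (Nat.cast (R := ℝ)) h
  push_cast at h'
  rw [lam, ← h', Finset.mul_sum]
  refine Finset.sum_congr rfl fun H _ => ?_
  split_ifs
  · have hc := AddSubgroup.card_eq_card_quotient_mul_card_addSubgroup H
    rw [Nat.card_prod, Nat.card_zmod, Nat.card_zmod] at hc
    have hc' := congrArg (Nat.cast (R := ℝ)) hc
    push_cast at hc'
    have h1 : (Nat.card H : ℝ) ≠ 0 := by exact_mod_cast Nat.card_pos.ne'
    have h2 : (Nat.card ((ZMod τ × ZMod σ) ⧸ H) : ℝ) ≠ 0 := by exact_mod_cast Nat.card_pos.ne'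
    rw [hc']
    field_simp
  · simp

end

section

variable {n τ σ : ℕ}

/-! ### Tiles and their representatives -/

/-- A representative of a tile. -/
noncomputable def Tile.block (T : Tile n τ σ) : Block n τ σ := Quotient.out (s := rotation n τ σ) T

/-- The tile of a block. -/
def Block.tile (A : Block n τ σ) : Tile n τ σ := Quotient.mk (rotation n τ σ) A

theorem Tile.tile_block (T : Tile n τ σ) : T.block.tile = T :=
  Quotient.out_eq (s := rotation n τ σ) T

theorem Block.tile_eq_iff {A B : Block n τ σ} : A.tile = B.tile ↔ (rotation n τ σ).r A B :=
  ⟨fun h => Quotient.exact h, fun h => Quotient.sound h⟩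

theorem Tile.block_injective : Function.Injective (Tile.block (n := n) (τ := τ) (σ := σ)) :=
  Function.LeftInverse.injective Tile.tile_block

theorem Block.isSimple_tile (A : Block n τ σ) :
    A.tile.IsSimple ↔ A.numAssignments = A.numStates := by
  have : A.tile.lag = (A.numAssignments : ℤ) - A.numStates := rfl
  rw [Tile.IsSimple, this]
  omega

variable [NeZero τ] [NeZero σ]

instance : Finite (Tile n τ σ) := Quotient.finite _

noncomputable instance : Fintype (Tile n τ σ) := Fintype.ofFinite _

theorem Block.tile_mem_simpleSolutions (f : Rule n) (A : Block n τ σ) :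
    A.tile ∈ simpleSolutions τ σ f ↔ A.Sat f ∧ A.Free ∧ A.numAssignments = A.numStates :=
  (and_congr (mk_mem_periodicSolutions f A) A.isSimple_tile).trans and_assoc

theorem Tile.mem_simpleSolutions (f : Rule n) (T : Tile n τ σ) :
    T ∈ simpleSolutions τ σ f ↔
      T.block.Sat f ∧ T.block.Free ∧ T.block.numAssignments = T.block.numStates := by
  rw [← T.block.tile_mem_simpleSolutions, T.tile_block]

/-- The probability that a tile is a simple periodic solution of a random rule. -/
noncomputable def Tile.prob (T : Tile n τ σ) : ℝ :=
  (ruleMeasure n).real {f | T ∈ simpleSolutions τ σ f}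

omit [NeZero τ] [NeZero σ] in
theorem Tile.prob_nonneg (T : Tile n τ σ) : 0 ≤ T.prob := measureReal_nonneg

open Classical in
theorem Block.prob_tile (hn : 1 ≤ n) (A : Block n τ σ) :
    A.tile.prob = if A.IsSimple then ((n : ℝ) ^ A.numStates)⁻¹ else 0 := by
  simp only [Tile.prob, A.tile_mem_simpleSolutions]
  split_ifs with h
  · rw [← h.2.2, ← real_sat hn A h.1]
    simp only [h.2.1, h.2.2, and_self, and_true]
  · have : {f | A.Sat f ∧ A.Free ∧ A.numAssignments = A.numStates} = ∅ := by
      ext f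
      simp only [Set.mem_ofPred_eq, Set.mem_empty_iff_false, iff_false]
      exact fun h' => h ⟨⟨f, h'.1⟩, h'.2⟩
    rw [this, measureReal_empty]

theorem Tile.prob_le (hn : 1 ≤ n) (T : Tile n τ σ) :
    T.prob ≤ ((n : ℝ) ^ T.block.numStates)⁻¹ := by
  classical
  rw [← T.tile_block, T.block.prob_tile hn, T.tile_block]
  split_ifs
  · rfl
  · positivity

open Classical in
theorem simpleCount_eq (f : Rule n) :
    simpleCount n τ σ f =
      (Finset.univ.filter fun T : Tile n τ σ => T ∈ simpleSolutions τ σ f).card := by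
  rw [simpleCount, ← Set.ncard_coe_finset]
  simp

theorem simpleMean_eq_sum_prob : simpleMean n τ σ = ∑ T : Tile n τ σ, T.prob := by
  classical
  simp only [simpleMean, integral_ruleMeasure, Tile.prob, ruleMeasure_real, Set.mem_ofPred_eq]
  rw [Finset.sum_comm]
  refine Finset.sum_congr rfl fun f _ => ?_
  rw [← Finset.mul_sum, simpleCount_eq]
  simp

open Classical in
theorem simpleLaw_real (S : Set ℕ) :
    (simpleLaw n τ σ).real S = ∑ f : Rule n, ruleWeight n * S.indicator 1
      (Finset.univ.filter fun T : Tile n τ σ => T ∈ simpleSolutions τ σ f).card := by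
  rw [simpleLaw, map_measureReal_apply (measurable_of_finite _) .of_discrete, ruleMeasure_real]
  refine Finset.sum_congr rfl fun f _ => ?_
  rw [← simpleCount_eq]
  simp [Set.indicator_apply]

/-! ### Sums over blocks -/

theorem sum_block_le (hn : 1 ≤ n) :
    ∑ A : Block n τ σ, ((n : ℝ) ^ A.numStates)⁻¹ ≤
      (Fintype.card (ZMod τ × ZMod σ) : ℝ) ^ Fintype.card (ZMod τ × ZMod σ) := by
  refine (Fintype.sum_equiv (Equiv.curry (ZMod τ) (ZMod σ) (Fin n)).symm _
    (fun u => ((n : ℝ) ^ (Set.range u).ncard)⁻¹) fun A => rfl).trans_le ?_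
  exact sum_inv_pow_ncard_range_le hn _

/-- A pair of blocks is one map on two disjoint copies of the torus. -/
theorem sum_block_block_le (hn : 1 ≤ n) :
    ∑ A : Block n τ σ, ∑ B : Block n τ σ,
        ((n : ℝ) ^ (Set.range (Sum.elim A.states B.states)).ncard)⁻¹ ≤
      (Fintype.card ((ZMod τ × ZMod σ) ⊕ (ZMod τ × ZMod σ)) : ℝ) ^
        Fintype.card ((ZMod τ × ZMod σ) ⊕ (ZMod τ × ZMod σ)) := by
  rw [← Fintype.sum_prod_type']
  refine (Fintype.sum_equiv (((Equiv.curry (ZMod τ) (ZMod σ) (Fin n)).symm.prodCongr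
      (Equiv.curry (ZMod τ) (ZMod σ) (Fin n)).symm).trans
      (Equiv.sumArrowEquivProdArrow _ _ _).symm) _
    (fun u => ((n : ℝ) ^ (Set.range u).ncard)⁻¹) fun A => rfl).trans_le ?_
  exact sum_inv_pow_ncard_range_le hn _

theorem sum_tile_le (F : Block n τ σ → ℝ) (hF : ∀ A, 0 ≤ F A) :
    ∑ T : Tile n τ σ, F T.block ≤ ∑ A, F A := by
  classical
  rw [← Finset.sum_image (f := F) (g := Tile.block) fun _ _ _ _ h => Tile.block_injective h]
  exact Finset.sum_le_sum_of_subset_of_nonneg (Finset.subset_univ _) fun A _ _ => hF A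

end

/-! ### Non-simple solutions -/

theorem real_nonsimple_le {n τ σ : ℕ} [NeZero τ] [NeZero σ] (hn : 1 ≤ n) :
    (ruleMeasure n).real {f | ∃ T ∈ periodicSolutions τ σ f, ¬ T.IsSimple} ≤
      (Fintype.card (ZMod τ × ZMod σ) : ℝ) ^ Fintype.card (ZMod τ × ZMod σ) / n := by
  classical
  have hK := sum_block_le (τ := τ) (σ := σ) hn
  have hsub : {f : Rule n | ∃ T ∈ periodicSolutions τ σ f, ¬ T.IsSimple} ⊆
      ⋃ A : Block n τ σ, {f | A.Sat f ∧ A.numStates + 1 ≤ A.numAssignments} := by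
    rintro f ⟨T, hT, hns⟩
    rw [← T.tile_block] at hT hns
    rw [Block.isSimple_tile] at hns
    have := T.block.numStates_le_numAssignments
    exact Set.mem_iUnion.2 ⟨T.block, ((mk_mem_periodicSolutions f _).1 hT).1, by omega⟩
  refine (measureReal_mono hsub).trans ((measureReal_iUnion_fintype_le _).trans ?_)
  rw [div_eq_inv_mul]
  -- The assignment in excess of the number of states supplies the factor `1/n`.
  refine le_trans ?_ (mul_le_mul_of_nonneg_left hK (by positivity))
  rw [Finset.mul_sum]
  refine Finset.sum_le_sum fun A _ => ?_
  by_cases h : A.numStates + 1 ≤ A.numAssignments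
  · simp only [h, and_true]
    refine (real_sat_le hn A).trans ?_
    rw [← mul_inv, ← pow_succ']
    have : (1 : ℝ) ≤ n := by exact_mod_cast hn
    gcongr
  · simp only [h, and_false, Set.ofPred_false, measureReal_empty]
    positivity

/-! ### The expected number of simple solutions -/

-- Each tile is spread evenly over its rotations, which turns the sum over tiles into a sum over
-- blocks; the latter are then grouped by kernel.
open Classical in
theorem simpleMean_eq {n τ σ : ℕ} [NeZero τ] [NeZero σ]
    [Fintype (AddSubgroup (ZMod τ × ZMod σ))] (hn : 1 ≤ n) :
    simpleMean n τ σ = ∑ H : AddSubgroup (ZMod τ × ZMod σ), if AxisFree H then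
      (n.descFactorial (Nat.card ((ZMod τ × ZMod σ) ⧸ H)) : ℝ) /
        (n : ℝ) ^ Nat.card ((ZMod τ × ZMod σ) ⧸ H) *
        ((Nat.card ((ZMod τ × ZMod σ) ⧸ H) : ℝ))⁻¹ else 0 := by
  have h1 : ∀ T : Tile n τ σ, T.prob = ∑ A : Block n τ σ, if A.tile = T then
      A.tile.prob * (({B | (rotation n τ σ).r A B}.ncard : ℝ))⁻¹ else 0 := by
    intro T
    have hc : ∀ A : Block n τ σ, A.tile = T →
        {B | (rotation n τ σ).r A B}.ncard =
          (Finset.univ.filter fun A : Block n τ σ => A.tile = T).card := by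
      rintro A rfl
      rw [← Set.ncard_coe_finset]
      congr 1
      ext B
      simp only [Finset.coe_filter, Finset.mem_univ, true_and, Set.mem_ofPred_eq]
      rw [eq_comm, Block.tile_eq_iff]
    rw [← Finset.sum_filter, Finset.sum_congr rfl (g := fun _ =>
      T.prob * ((Finset.univ.filter fun A : Block n τ σ => A.tile = T).card : ℝ)⁻¹)]
    · have h0 : ((Finset.univ.filter fun A : Block n τ σ => A.tile = T).card : ℝ) ≠ 0 := by
        rw [Nat.cast_ne_zero, Finset.card_ne_zero]
        exact ⟨T.block, by simp [T.tile_block]⟩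
      rw [Finset.sum_const, nsmul_eq_mul]
      field_simp
    · intro A hA
      have hA' := (Finset.mem_filter.1 hA).2
      rw [hc A hA', hA']
  have h2 : ∀ A : Block n τ σ, A.tile.prob * (({B | (rotation n τ σ).r A B}.ncard : ℝ))⁻¹ =
      ∑ H : AddSubgroup (ZMod τ × ZMod σ), if AxisFree H then if A.HasKernel H then
        ((n : ℝ) ^ Nat.card ((ZMod τ × ZMod σ) ⧸ H))⁻¹ *
        ((Nat.card ((ZMod τ × ZMod σ) ⧸ H) : ℝ))⁻¹ else 0 else 0 := by
    intro A
    rw [A.prob_tile hn]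
    by_cases hA : A.IsSimple
    · obtain ⟨H, hH, hK⟩ := A.isSimple_iff.1 hA
      rw [Finset.sum_eq_single H, if_pos hA, if_pos hH, if_pos hK, hK.ncard_rotations,
        hK.numStates_eq]
      · intro H' _ hne
        rw [if_neg fun h : A.HasKernel H' => hne (h.unique hK), ite_self]
      · simp
    · rw [if_neg hA, zero_mul, eq_comm]
      refine Finset.sum_eq_zero fun H _ => ?_
      split_ifs with hH hK
      · exact absurd (A.isSimple_iff.2 ⟨H, hH, hK⟩) hA
      · rfl
      · rfl
  rw [simpleMean_eq_sum_prob, Finset.sum_congr rfl fun T _ => h1 T, Finset.sum_comm]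
  simp only [Finset.sum_ite_eq, Finset.mem_univ, if_true, h2]
  rw [Finset.sum_comm]
  refine Finset.sum_congr rfl fun H _ => ?_
  by_cases hH : AxisFree H
  · have hc : Nat.card {A : Block n τ σ // A.HasKernel H} =
        (Finset.univ.filter fun A : Block n τ σ => A.HasKernel H).card := by
      rw [Nat.card_eq_fintype_card, Fintype.card_subtype]
    simp only [hH, if_true]
    rw [← Finset.sum_filter, Finset.sum_const, nsmul_eq_mul, ← card_hasKernel n H, hc,
      div_eq_mul_inv, mul_assoc]
  · simp [hH]

theorem tendsto_simpleMean (τ σ : ℕ) [NeZero τ] [NeZero σ] :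
    Tendsto (fun n : ℕ => simpleMean n τ σ) atTop (𝓝 (lam τ σ)) := by
  classical
  have := Fintype.ofFinite (AddSubgroup (ZMod τ × ZMod σ))
  rw [lam_eq_sum]
  refine Tendsto.congr' ((eventually_ge_atTop 1).mono fun n hn => (simpleMean_eq hn).symm) ?_
  refine tendsto_finsetSum _ fun H _ => ?_
  split_ifs
  · have h := (isEquivalent_descFactorial (Nat.card ((ZMod τ × ZMod σ) ⧸ H)))
    have h1 := (Asymptotics.isEquivalent_iff_tendsto_one
      ((eventually_ge_atTop 1).mono fun n hn => by
        have : (1 : ℝ) ≤ n := by exact_mod_cast hn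
        positivity)).1 h
    simpa using h1.mul_const ((Nat.card ((ZMod τ × ZMod σ) ⧸ H) : ℝ))⁻¹
  · exact tendsto_const_nhds

theorem simpleMean_nonneg {n τ σ : ℕ} [NeZero τ] [NeZero σ] : 0 ≤ simpleMean n τ σ := by
  rw [simpleMean_eq_sum_prob]
  exact Finset.sum_nonneg fun T _ => T.prob_nonneg

theorem simpleMean_le {n τ σ : ℕ} [NeZero τ] [NeZero σ] (hn : 1 ≤ n) : simpleMean n τ σ ≤
    (Fintype.card (ZMod τ × ZMod σ) : ℝ) ^ Fintype.card (ZMod τ × ZMod σ) := by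
  have hK := sum_block_le (τ := τ) (σ := σ) hn
  rw [simpleMean_eq_sum_prob]
  refine (Finset.sum_le_sum fun T _ => T.prob_le hn).trans ?_
  exact (sum_tile_le (fun A => ((n : ℝ) ^ A.numStates)⁻¹) fun A => by positivity).trans hK

/-! ### Poisson approximation -/

/-- Two tiles are neighbors if they have a common state. -/
def Tile.Shares {n τ σ : ℕ} (T T' : Tile n τ σ) : Prop :=
  ∃ p q, T.block.states p = T'.block.states q

/-- Without a common state the adjacent pairs of `T` and `T'` differ already in their first entries,
so `T'` never queries the rule where `T` does. This is the independence needed for `chen_stein`. -/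
theorem Tile.mem_simpleSolutions_congr {n τ σ : ℕ} [NeZero τ] [NeZero σ] {f g : Rule n}
    {T T' : Tile n τ σ} (h : ¬ T.Shares T') (hfg : ∀ x, x ∉ Set.range T.block.pairs → f x = g x) :
    T' ∈ simpleSolutions τ σ f ↔ T' ∈ simpleSolutions τ σ g := by
  have key : ∀ p, f (T'.block.pairs p) = g (T'.block.pairs p) := by
    intro p
    refine hfg _ ?_
    rintro ⟨q, hq⟩
    exact h ⟨q, p, congrArg Prod.fst hq⟩
  have : T'.block.Sat f ↔ T'.block.Sat g := forall_congr' fun p => by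
    have := key p
    simp only [Block.pairs] at this
    rw [this]
  rw [Tile.mem_simpleSolutions, Tile.mem_simpleSolutions, this]

open Classical in
theorem sum_shares_prob_mul_le {n τ σ : ℕ} [NeZero τ] [NeZero σ] (hn : 1 ≤ n) :
    (∑ T : Tile n τ σ, ∑ T' : Tile n τ σ, if T.Shares T' then T.prob * T'.prob else 0) ≤
      (n : ℝ)⁻¹ * ∑ A : Block n τ σ, ∑ B : Block n τ σ,
        ((n : ℝ) ^ (Set.range (Sum.elim A.states B.states)).ncard)⁻¹ := by
  have hn1 : (1 : ℝ) ≤ n := by exact_mod_cast hn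
  simp only [Finset.mul_sum]
  refine le_trans (Finset.sum_le_sum fun T _ => ?_) (sum_tile_le (fun A => ∑ B : Block n τ σ,
    (n : ℝ)⁻¹ * ((n : ℝ) ^ (Set.range (Sum.elim A.states B.states)).ncard)⁻¹)
    fun A => Finset.sum_nonneg fun B _ => by positivity)
  refine le_trans (Finset.sum_le_sum fun T' _ => ?_) (sum_tile_le (fun B =>
    (n : ℝ)⁻¹ * ((n : ℝ) ^ (Set.range (Sum.elim T.block.states B.states)).ncard)⁻¹)
    fun A => by positivity)
  split_ifs with h
  · refine (mul_le_mul (T.prob_le hn) (T'.prob_le hn) T'.prob_nonneg (by positivity)).trans ?_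
    rw [← mul_inv, ← mul_inv, ← pow_add, ← pow_succ']
    have := ncard_range_elim_lt _ _ h
    gcongr
  · positivity

open Classical in
theorem sum_shares_joint_le {n τ σ : ℕ} [NeZero τ] [NeZero σ] (hn : 1 ≤ n) :
    (∑ T : Tile n τ σ, ∑ T' : Tile n τ σ, if T.Shares T' ∧ T' ≠ T then
      ∑ f : Rule n, ruleWeight n *
        (if T ∈ simpleSolutions τ σ f ∧ T' ∈ simpleSolutions τ σ f then 1 else 0) else 0) ≤
      (n : ℝ)⁻¹ * ∑ A : Block n τ σ, ∑ B : Block n τ σ,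
        ((n : ℝ) ^ (Set.range (Sum.elim A.states B.states)).ncard)⁻¹ := by
  simp only [Finset.mul_sum]
  refine le_trans (Finset.sum_le_sum fun T _ => ?_) (sum_tile_le (fun A => ∑ B : Block n τ σ,
    (n : ℝ)⁻¹ * ((n : ℝ) ^ (Set.range (Sum.elim A.states B.states)).ncard)⁻¹)
    fun A => Finset.sum_nonneg fun B _ => by positivity)
  refine le_trans (Finset.sum_le_sum fun T' _ => ?_) (sum_tile_le (fun B =>
    (n : ℝ)⁻¹ * ((n : ℝ) ^ (Set.range (Sum.elim T.block.states B.states)).ncard)⁻¹)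
    fun A => by positivity)
  split_ifs with h
  · have h1 := ruleMeasure_real
      {f : Rule n | T ∈ simpleSolutions τ σ f ∧ T' ∈ simpleSolutions τ σ f}
    simp only [Set.mem_ofPred_eq] at h1
    refine le_trans (le_of_eq (Eq.trans ?_ h1.symm)) ?_
    · exact Finset.sum_congr rfl fun f _ => by congr
    refine (measureReal_mono ?_).trans (real_sat_sat_le hn T.block T'.block ?_ h.1)
    · rintro f ⟨hf, hf'⟩
      exact ⟨((T.mem_simpleSolutions f).1 hf).1, ((T'.mem_simpleSolutions f).1 hf').1⟩
    · rw [← Block.tile_eq_iff, T.tile_block, T'.tile_block]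
      exact fun e => h.2 e.symm
  · positivity

/-- The constant in the Poisson approximation. -/
noncomputable def poissonConst (τ σ : ℕ) [NeZero τ] [NeZero σ] : ℝ :=
  4 * Real.exp ((Fintype.card (ZMod τ × ZMod σ) : ℝ) ^ Fintype.card (ZMod τ × ZMod σ)) *
    (Fintype.card ((ZMod τ × ZMod σ) ⊕ (ZMod τ × ZMod σ)) : ℝ) ^
        Fintype.card ((ZMod τ × ZMod σ) ⊕ (ZMod τ × ZMod σ))

theorem abs_simpleLaw_sub_le {n τ σ : ℕ} [NeZero τ] [NeZero σ] (hn : 1 ≤ n) (S : Set ℕ) :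
    |(simpleLaw n τ σ).real S -
      (ProbabilityTheory.poissonMeasure (simpleMean n τ σ).toNNReal).real S| ≤
        poissonConst τ σ / n := by
  classical
  have hr : ((simpleMean n τ σ).toNNReal : ℝ) = simpleMean n τ σ :=
    Real.coe_toNNReal _ simpleMean_nonneg
  have h := chen_stein (Ω := Rule n) (ι := Tile n τ σ) (fun _ => ruleWeight n)
    (fun _ => ruleWeight_nonneg n) (sum_ruleWeight n) (fun T f => T ∈ simpleSolutions τ σ f)
    Tile.Shares (fun T => ⟨0, 0, rfl⟩) Tile.prob (fun T => ruleMeasure_real _) ?_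
    (simpleMean n τ σ).toNNReal (by rw [hr, simpleMean_eq_sum_prob]) S
  · rw [simpleLaw_real]
    refine h.trans ?_
    rw [hr]
    have hb := (add_le_add (sum_shares_prob_mul_le (τ := τ) (σ := σ) hn)
      (sum_shares_joint_le (τ := τ) (σ := σ) hn))
    refine (mul_le_mul_of_nonneg_left hb (by positivity)).trans ?_
    have hK := sum_block_block_le (τ := τ) (σ := σ) hn
    have hE := Real.exp_le_exp.2 (simpleMean_le (τ := τ) (σ := σ) hn)
    set Q := ∑ A : Block n τ σ, ∑ B : Block n τ σ,
        ((n : ℝ) ^ (Set.range (Sum.elim A.states B.states)).ncard)⁻¹ with hQ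
    have hQ0 : 0 ≤ Q := Finset.sum_nonneg fun A _ => Finset.sum_nonneg fun B _ => by positivity
    have hmul := mul_le_mul hE hK hQ0 (Real.exp_pos _).le
    rw [poissonConst, div_eq_mul_inv]
    have hn0 : (0 : ℝ) ≤ (n : ℝ)⁻¹ := by positivity
    -- The 4 is the factor 2 of `chen_stein` times the two error sums, each at most `Q / n`.
    have := mul_le_mul_of_nonneg_left hmul (mul_nonneg (by norm_num : (0 : ℝ) ≤ 4) hn0)
    linarith
  · intro T F
    by_cases hT : T.block.Free ∧ T.block.numAssignments = T.block.numStates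
    · have hX : ∀ f : Rule n, T ∈ simpleSolutions τ σ f ↔
          ∀ p, f (T.block.pairs p) = T.block (p.1 + 1) (p.2 + 1) := by
        intro f
        rw [T.mem_simpleSolutions]
        exact and_iff_left hT
      have hi := sum_constraints_mul hn T.block.pairs
        (fun p => T.block (p.1 + 1) (p.2 + 1))
        (fun f => F (Finset.univ.filter fun T' => ¬ T.Shares T' ∧ T' ∈ simpleSolutions τ σ f).card)
        (by
          intro f g hfg
          refine congrArg F (congrArg Finset.card (Finset.filter_congr fun T' _ => ?_))
          exact and_congr_right fun hs => Tile.mem_simpleSolutions_congr hs hfg)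
      simp only [← hX] at hi
      exact hi
    -- A tile that is not free or not simple never occurs, and both sides vanish.
    · have hX : ∀ f : Rule n, T ∉ simpleSolutions τ σ f := by
        intro f h
        exact hT ((T.mem_simpleSolutions f).1 h).2
      simp [Tile.prob, hX]

theorem tvDist_simpleLaw_le {n τ σ : ℕ} [NeZero τ] [NeZero σ] (hn : 1 ≤ n) :
    tvDist (simpleLaw n τ σ)
      (ProbabilityTheory.poissonMeasure (simpleMean n τ σ).toNNReal) ≤ poissonConst τ σ / n :=
  ciSup_le fun S => abs_simpleLaw_sub_le hn S

/-- Existence of a solution and existence of a simple one differ by an event of probability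
`O(1/n)`. The latter is the event `{0}ᶜ` for the simple count, whose Poisson mass is `1 -
exp(-λ_n)`. -/
theorem tendsto_real_nonempty (τ σ : ℕ) [NeZero τ] [NeZero σ] :
    Tendsto (fun n : ℕ => (ruleMeasure n).real {f | (periodicSolutions τ σ f).Nonempty})
      atTop (𝓝 (1 - Real.exp (-lam τ σ))) := by
  have hlim : Tendsto (fun n : ℕ => 1 - Real.exp (-simpleMean n τ σ)) atTop
      (𝓝 (1 - Real.exp (-lam τ σ))) :=
    ((Real.continuous_exp.tendsto _).comp (tendsto_simpleMean τ σ).neg).const_sub 1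
  have hz : ∀ C : ℝ, Tendsto (fun n : ℕ => C / n) atTop (𝓝 0) := fun C =>
    tendsto_const_div_atTop_nhds_zero_nat C
  have hlaw : ∀ n : ℕ, 1 ≤ n → |(ruleMeasure n).real {f | (simpleSolutions τ σ f).Nonempty} -
      (1 - Real.exp (-simpleMean n τ σ))| ≤ poissonConst τ σ / n := by
    intro n hn
    have h := abs_simpleLaw_sub_le (τ := τ) (σ := σ) hn {0}ᶜ
    have e : simpleCount n τ σ ⁻¹' {0}ᶜ = {f | (simpleSolutions τ σ f).Nonempty} := by
      ext f
      simp only [Set.mem_preimage, Set.mem_compl_iff, Set.mem_singleton_iff, Set.mem_ofPred_eq,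
        simpleCount]
      rw [Set.ncard_eq_zero, Set.nonempty_iff_ne_empty]
    rw [simpleLaw, map_measureReal_apply (measurable_of_finite _) .of_discrete, e,
      probReal_compl_eq_one_sub .of_discrete, ProbabilityTheory.poissonMeasure_real_singleton,
      Real.coe_toNNReal _ simpleMean_nonneg] at h
    simpa using h
  refine tendsto_of_tendsto_of_tendsto_of_le_of_le'
    (g := fun n : ℕ => 1 - Real.exp (-simpleMean n τ σ) - poissonConst τ σ / n)
    (h := fun n : ℕ => 1 - Real.exp (-simpleMean n τ σ) + poissonConst τ σ / n +
      (Fintype.card (ZMod τ × ZMod σ) : ℝ) ^ Fintype.card (ZMod τ × ZMod σ) / n)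
    (by simpa using hlim.sub (hz _)) (by simpa using (hlim.add (hz _)).add (hz _)) ?_ ?_
  · filter_upwards [eventually_ge_atTop 1] with n hn
    have h1 := (abs_le.1 (hlaw n hn)).1
    have h2 : (ruleMeasure n).real {f | (simpleSolutions τ σ f).Nonempty} ≤
        (ruleMeasure n).real {f | (periodicSolutions τ σ f).Nonempty} :=
      measureReal_mono fun f hf => hf.mono fun T hT => hT.1
    linarith
  · filter_upwards [eventually_ge_atTop 1] with n hn
    have h1 := (abs_le.1 (hlaw n hn)).2
    have h2 : {f : Rule n | (periodicSolutions τ σ f).Nonempty} ⊆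
        {f | (simpleSolutions τ σ f).Nonempty} ∪
          {f | ∃ T ∈ periodicSolutions τ σ f, ¬ T.IsSimple} := by
      rintro f ⟨T, hT⟩
      by_cases hs : T.IsSimple
      · exact Or.inl ⟨T, hT, hs⟩
      · exact Or.inr ⟨T, hT, hs⟩
    have h3 := (measureReal_mono h2).trans (measureReal_union_le (μ := ruleMeasure n) _ _)
    have h4 := real_nonsimple_le (τ := τ) (σ := σ) hn
    linarith

end RandomCA


/-! ### The main theorem -/

theorem theorem1 (τ σ : ℕ) (hτ : 1 ≤ τ) (hσ : 1 ≤ σ) :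
    Tendsto
      (fun n : ℕ => (RandomCA.ruleMeasure n).real
        {f | (RandomCA.periodicSolutions τ σ f).Nonempty})
      atTop (𝓝 (1 - Real.exp (-RandomCA.lam τ σ))) ∧
    (∃ C : ℝ, ∀ n : ℕ, 1 ≤ n →
      (RandomCA.ruleMeasure n).real
        {f | ∃ T ∈ RandomCA.periodicSolutions τ σ f, ¬ T.IsSimple} ≤ C / n) ∧
    (∃ C : ℝ, ∀ n : ℕ, 1 ≤ n →
      RandomCA.tvDist (RandomCA.simpleLaw n τ σ)
        (ProbabilityTheory.poissonMeasure (RandomCA.simpleMean n τ σ).toNNReal) ≤ C / n) ∧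
    Tendsto (fun n : ℕ => RandomCA.simpleMean n τ σ) atTop (𝓝 (RandomCA.lam τ σ)) := by
  have : NeZero τ := ⟨by omega⟩
  have : NeZero σ := ⟨by omega⟩
  exact ⟨RandomCA.tendsto_real_nonempty τ σ, ⟨_, fun n hn => RandomCA.real_nonsimple_le hn⟩,
    ⟨_, fun n hn => RandomCA.tvDist_simpleLaw_le hn⟩, RandomCA.tendsto_simpleMean τ σ⟩
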